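/- Let $k$ be an algebraically closed field. For integers $0\le r\le n+1$ let $\mathbb{G}(r-1,n)$ denote the Grassmannian of $(r-1)$-planes in $\mathbb{P}^n_k$, that is, the set of $r$-dimensional linear subspaces of $k^{n+1}$, with its Zariski topology (so $\mathbb{G}(-1,n)$ is a single point, the empty plane). The codimension of a subset $Z$ of a Grassmannian $\mathbb{G}$ is $\dim\mathbb{G}-\dim\overline{Z}$, where $\overline{Z}$ is the Zariski closure and $\dim$ is Krull dimension; for a subvariety $Z$ this is the usual codimension. Let $0\le m\le n$ and $\epsilon\ge 1$ be integers. Let $B\subset\mathbb{G}(m,n)$ be an irreducible subset (for instance an irreducible subvariety) of codimension at least $\epsilon$. Let $C\subset\mathbb{G}(m-1,n)$ be a nonempty subset (for instance a nonempty subvariety, not necessarily irreducible) such that for every $c\in C$, every $b\in\mathbb{G}(m,n)$ with $c\subset b$ lies in $B$. Then the codimension of $C$ in $\mathbb{G}(m-1,n)$ is at least $\epsilon+1$. -/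

import Mathlib

/-- `Gr k N r`: the set of `r`-dimensional linear subspaces of `k ^ N`.
In projective terms, `Gr k (n + 1) (m + 1)` is the Grassmannian `𝔾(m, n)` of `m`-planes in
`ℙ ^ n`, an `m`-plane being identified with the cone over it in `k ^ (n + 1)`; in the same way
`Gr k (n + 1) m` is `𝔾(m - 1, n)`, which for `m = 0` is one point, the empty plane. -/
def Gr (k : Type*) [Field k] (N r : ℕ) : Type _ :=
  {W : Submodule k (Fin N → k) // Module.finrank k W = r}

/-- The `r`-frames in `k ^ N`: linearly independent families of `r` vectors, that is,
`r × N` matrices of rank `r`, a Zariski open subset of the affine space of matrices. -/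
def Frame (k : Type*) [Field k] (N r : ℕ) : Type _ :=
  {A : Fin r → Fin N → k // LinearIndependent k A}

namespace Frame

variable {k : Type*} [Field k] {N r : ℕ}

/-- The point of affine space `𝔸 ^ (r * N)` given by the entries of a frame. -/
def coords (A : Frame k N r) : Fin r × Fin N → k := fun p => A.1 p.1 p.2

/-- The Zariski topology on frames: the subspace topology from affine space. A subset is closed
iff it is the set of frames at whose entries every member of some set of polynomials vanishes. -/
noncomputable instance zariskiTopology : TopologicalSpace (Frame k N r) :=
  TopologicalSpace.induced (fun A => MvPolynomial.pointToPoint (k := k) (coords A)) inferInstance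

/-- The subspace spanned by a frame. -/
def span (A : Frame k N r) : Gr k N r :=
  ⟨Submodule.span k (Set.range A.1), by simpa using finrank_span_eq_card A.2⟩

end Frame

/-- The Zariski topology on the Grassmannian. The Grassmannian is the quotient of the variety of
frames by `GL_r`, and its topology is the quotient topology: a set of subspaces is closed iff the
set of all frames spanning a member of it is Zariski closed. -/
noncomputable instance Gr.zariskiTopology {k : Type*} [Field k] {N r : ℕ} : TopologicalSpace (Gr k N r) :=
  TopologicalSpace.coinduced Frame.span inferInstance

/-- `CodimAtLeast Z e`: the subset `Z` of `X` has codimension at least `e`, where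
the codimension is `dim X - dim Z` and the dimension of a subset is the Krull dimension of
its closure (for a subvariety of an algebraic variety this is its own Krull dimension).
The empty set has dimension `⊥`, hence codimension at least every `e`. -/
def CodimAtLeast {X : Type*} [TopologicalSpace X] (Z : Set X) (e : ℕ) : Prop :=
  topologicalKrullDim (closure Z) + (e : WithBot ℕ∞) ≤ topologicalKrullDim X

/-! Write `N = n + 1`. The incidence hypothesis passes to closures (`mem_closure_of_incidence`), so
`B` and `C` may be taken closed; `B` is proper because `1 ≤ ε`. Dimensions are then compared on
frames of `m + 1` vectors. Let `F_B` be the frames whose span lies in `B`, and `F_C` those whose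
first `m` vectors span a member of `C`. Then `F_C` is a closed subset of `F_B`, and `F_B` is
irreducible. If they were equal, every `m`-dimensional subspace of a member of `B` would lie in `C`;
since any two `(m + 1)`-dimensional subspaces are joined by a chain of neighbours, `B` would be
everything (`Gr.eq_univ_of_incidence`). Hence `dim F_C + 1 ≤ dim F_B`.

Choosing bases gives `dim F_C ≥ dim C + m² + N`, where `N` counts the last vector, and `dim F_B ≤
dim B + (m + 1)²`. Also `dim Gr k N r + r² = r N` for `r ≤ N`. Together, `dim C + m² + N + 1 + ε ≤
(m + 1) N`, that is, `dim C + ε + 1 ≤ m N - m²`.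

The counts are local. Where `A * L` is invertible, a frame `A` is a pair of an invertible matrix and
a frame in the slice `A * L = 1`. The slice is an open piece of the Grassmannian and is also closed
in affine space, so the Nullstellensatz turns its dimension into that of a ring, and each further
free coordinate adds one. -/

open Topology TopologicalSpace

/-! ### Krull dimension of topological spaces -/

section Krull

variable {X Y : Type*} [TopologicalSpace X] [TopologicalSpace Y]

/-- Lets an inequality of dimensions be proved for one chain at a time. The infinite case is covered
because a `b` above every natural number is `⊤`. -/
lemma add_natCast_le_of_forall_natCast {a b : WithBot ℕ∞} {e : ℕ}
    (h : ∀ n : ℕ, (n : WithBot ℕ∞) ≤ a → ((n + e : ℕ) : WithBot ℕ∞) ≤ b) : a + e ≤ b := by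
  have top_of : (∀ n : ℕ, (n : WithBot ℕ∞) ≤ b) → b = ⊤ := by
    intro hb
    induction b with
    | bot => exact absurd (hb 0) (by simp)
    | coe b =>
      have : b = ⊤ := ENat.eq_top_iff_forall_ge.2 fun m => by
        have := hb m
        exact_mod_cast this
      rw [this]; rfl
  induction a with
  | bot => simp
  | coe a =>
    induction a with
    | top =>
      rw [top_of fun n => (Nat.cast_le.2 (Nat.le_add_right n e)).trans (h n le_top)]
      exact le_top
    | coe a => simpa using h a le_rfl

lemma le_of_forall_natCast {a b : WithBot ℕ∞}
    (h : ∀ n : ℕ, (n : WithBot ℕ∞) ≤ a → (n : WithBot ℕ∞) ≤ b) : a ≤ b := by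
  simpa using add_natCast_le_of_forall_natCast (e := 0) (a := a) (b := b) (by simpa using h)

/-- An open set that meets the smallest member of a chain meets all of them, and irreducible closed
sets meeting an open set are determined by their traces on it. So the whole chain survives in one
member of the cover. -/
lemma exists_le_topologicalKrullDim_of_open_cover {ι : Type*} {U : ι → Set X}
    (hU : ∀ i, IsOpen (U i)) (hc : ∀ x, ∃ i, x ∈ U i) {n : ℕ}
    (h : (n : WithBot ℕ∞) ≤ topologicalKrullDim X) :
    ∃ i, (n : WithBot ℕ∞) ≤ topologicalKrullDim (U i) := by
  obtain ⟨l, rfl⟩ := Order.le_krullDim_iff.1 h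
  obtain ⟨x, hx⟩ := (l 0).isIrreducible.nonempty
  obtain ⟨i, hi⟩ := hc x
  refine ⟨i, Order.le_krullDim_iff.2 ?_⟩
  have he := (hU i).isOpenEmbedding_subtypeVal
  let φ := IrreducibleCloseds.orderIsoOfIsOpenEmbedding _ he
  have hne : ∀ j, (((↑) : U i → X) ⁻¹' (l j : Set X)).Nonempty := fun j =>
    ⟨⟨x, hi⟩, (l.strictMono.monotone (Fin.zero_le j) : l 0 ≤ l j) hx⟩
  refine ⟨LTSeries.mk l.length (fun j => φ.symm ⟨l j, hne j⟩) fun a b hab => ?_, rfl⟩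
  exact φ.symm.strictMono (l.strictMono hab)

/-- The whole space can be put on top of any chain of irreducible closed subsets of `E`. -/
lemma topologicalKrullDim_add_one_le [IrreducibleSpace Y] {E : Set Y} (hE : IsClosed E)
    (hne : E ≠ Set.univ) : topologicalKrullDim E + 1 ≤ topologicalKrullDim Y := by
  refine add_natCast_le_of_forall_natCast (e := 1) fun n hn => ?_
  obtain ⟨l, rfl⟩ := Order.le_krullDim_iff.1 hn
  let l' := l.map _ (IrreducibleCloseds.map_strictMono_of_isInducing
    (IsInducing.subtypeVal (t := E)))
  let T : IrreducibleCloseds Y := ⟨Set.univ, IrreducibleSpace.isIrreducible_univ Y, isClosed_univ⟩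
  have hl : l'.last < T := by
    refine lt_of_le_of_ne (fun _ _ => trivial) fun h => hne (Set.univ_subset_iff.1 ?_)
    have h1 : (l'.last : Set Y) = Set.univ := by rw [h]; rfl
    rw [← h1]
    exact closure_minimal (by rintro _ ⟨a, -, rfl⟩; exact a.2) hE
  exact Order.le_krullDim_iff.2 ⟨l'.snoc T hl, by simp [l']⟩

end Krull

/-! ### Zariski topologies given by coordinates, and regular functions -/

section Zariski

open MvPolynomial

variable {k : Type*} [Field k] {σ τ ρ : Type*} {X Y : Type*}

/-- `X` carries the Zariski topology defined by the coordinates `β`. -/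
def IsZariski [TopologicalSpace X] (β : X → σ → k) : Prop :=
  IsInducing fun x => MvPolynomial.pointToPoint (k := k) (β x)

/-- The functions on `X` that are polynomials in the coordinates `β`. -/
noncomputable def regularFunctions (β : X → σ → k) : Subalgebra k (X → k) :=
  (aeval (R := k) fun i x => β x i).range

lemma coord_mem_regularFunctions (β : X → σ → k) (i : σ) :
    (fun x => β x i) ∈ regularFunctions β := ⟨MvPolynomial.X i, by simp⟩

lemma const_mem_regularFunctions (β : X → σ → k) (c : k) :
    (fun _ => c) ∈ regularFunctions β := (regularFunctions β).algebraMap_mem c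

lemma aeval_pi_apply (β : X → σ → k) (p : MvPolynomial σ k) (x : X) :
    aeval (R := k) (fun i x => β x i) p x = aeval (β x) p := by
  have : (Pi.evalAlgHom k (fun _ : X => k) x).comp (aeval (R := k) fun i x => β x i)
      = aeval (β x) := by ext; simp
  exact DFunLike.congr_fun this p

lemma regularFunctions_comp {γ : Y → τ → k} (f : X → Y) {h : Y → k}
    (hh : h ∈ regularFunctions γ) :
    (fun x => h (f x)) ∈ regularFunctions fun x => γ (f x) := by
  obtain ⟨p, rfl⟩ := hh
  refine ⟨p, funext fun x => ?_⟩
  change aeval (R := k) (fun i x => γ (f x) i) p x = aeval (R := k) (fun i y => γ y i) p (f x)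
  rw [aeval_pi_apply (fun x => γ (f x)), aeval_pi_apply γ]

/-- Clearing denominators: substituting fractions with common denominator `q` into a polynomial
gives a fraction whose denominator is a power of `q`. -/
lemma exists_aeval_mul_pow_mem_regularFunctions {β : X → σ → k} {g : X → τ → k} {q : X → k}
    (hq : q ∈ regularFunctions β) (hg : ∀ j, (fun x => g x j * q x) ∈ regularFunctions β)
    (p : MvPolynomial τ k) :
    ∃ D : ℕ, (fun x => aeval (g x) p * q x ^ D) ∈ regularFunctions β := by
  induction p using MvPolynomial.induction_on with
  | C a => exact ⟨0, by simpa using const_mem_regularFunctions β a⟩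
  | add p₁ p₂ h₁ h₂ =>
    obtain ⟨D₁, h₁⟩ := h₁
    obtain ⟨D₂, h₂⟩ := h₂
    refine ⟨D₁ + D₂, ?_⟩
    convert add_mem (mul_mem h₁ (pow_mem hq D₂)) (mul_mem h₂ (pow_mem hq D₁)) using 1
    funext x
    simp only [map_add, Pi.add_apply, Pi.mul_apply, Pi.pow_apply]
    ring
  | mul_X p j h =>
    obtain ⟨D, h⟩ := h
    refine ⟨D + 1, ?_⟩
    convert mul_mem h (hg j) using 1
    funext x
    simp only [map_mul, aeval_X, Pi.mul_apply]
    ring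

variable [TopologicalSpace X] [TopologicalSpace Y]

lemma IsZariski.comp {β : X → σ → k} (h : IsZariski β) {f : Y → X} (hf : IsInducing f) :
    IsZariski (fun y => β (f y)) :=
  IsInducing.comp h hf

lemma pointToPoint_mem_zeroLocus {I : Ideal (MvPolynomial σ k)} {x : σ → k} :
    MvPolynomial.pointToPoint (k := k) x ∈ PrimeSpectrum.zeroLocus (I : Set (MvPolynomial σ k)) ↔
      x ∈ MvPolynomial.zeroLocus k I := by
  change (∀ p ∈ I, p ∈ vanishingIdeal k {x}) ↔ _
  simp

lemma IsZariski.isClosed_iff {β : X → σ → k} (h : IsZariski β) {Z : Set X} :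
    IsClosed Z ↔ ∃ I : Ideal (MvPolynomial σ k), Z = β ⁻¹' MvPolynomial.zeroLocus k I := by
  rw [IsInducing.isClosed_iff h]
  constructor
  · rintro ⟨t, ht, rfl⟩
    obtain ⟨I, rfl⟩ := (PrimeSpectrum.isClosed_iff_zeroLocus_ideal _).1 ht
    exact ⟨I, Set.ext fun x => pointToPoint_mem_zeroLocus (x := β x)⟩
  · rintro ⟨I, rfl⟩
    exact ⟨PrimeSpectrum.zeroLocus I, PrimeSpectrum.isClosed_zeroLocus _,
      Set.ext fun x => pointToPoint_mem_zeroLocus⟩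

lemma IsZariski.isClosed_setOf_eq_zero {β : X → σ → k} (h : IsZariski β) {f : X → k}
    (hf : f ∈ regularFunctions β) : IsClosed {x | f x = 0} := by
  obtain ⟨p, rfl⟩ := hf
  refine h.isClosed_iff.2 ⟨Ideal.span {p}, Set.ext fun x => ?_⟩
  rw [MvPolynomial.zeroLocus_span]
  change aeval (R := k) (fun i x => β x i) p x = 0 ↔
    ∀ q ∈ ({p} : Set (MvPolynomial σ k)), aeval (β x) q = 0
  rw [aeval_pi_apply β p x]
  simp only [Set.mem_singleton_iff, forall_eq]

lemma IsZariski.isOpen_setOf_ne_zero {β : X → σ → k} (h : IsZariski β) {f : X → k}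
    (hf : f ∈ regularFunctions β) : IsOpen {x | f x ≠ 0} :=
  (h.isClosed_setOf_eq_zero hf).isOpen_compl

/-- Maps given by fractions with a nonvanishing denominator are Zariski continuous. -/
lemma IsZariski.continuous_of_fraction {α : X → σ → k} {γ : Y → τ → k} (hα : IsZariski α)
    (hγ : IsZariski γ) {f : X → Y} {q : X → k} (hq : q ∈ regularFunctions α)
    (hq0 : ∀ x, q x ≠ 0) (hf : ∀ j, (fun x => γ (f x) j * q x) ∈ regularFunctions α) :
    Continuous f := by
  refine continuous_iff_isClosed.2 fun Z hZ => ?_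
  obtain ⟨I, rfl⟩ := hγ.isClosed_iff.1 hZ
  have : f ⁻¹' (γ ⁻¹' MvPolynomial.zeroLocus k I)
      = ⋂ p ∈ I, {x | aeval (γ (f x)) p = 0} := by ext x; simp
  rw [this]
  refine isClosed_biInter fun p _ => ?_
  obtain ⟨D, hD⟩ := exists_aeval_mul_pow_mem_regularFunctions hq hf p
  convert hα.isClosed_setOf_eq_zero hD using 3
  simp [hq0]

lemma IsZariski.continuous_of_regular {α : X → σ → k} {γ : Y → τ → k} (hα : IsZariski α)
    (hγ : IsZariski γ) {f : X → Y} (hf : ∀ j, (fun x => γ (f x) j) ∈ regularFunctions α) :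
    Continuous f :=
  hα.continuous_of_fraction hγ (q := fun _ => 1) (const_mem_regularFunctions α 1)
    (fun _ => one_ne_zero) (by simpa using hf)

/-- A continuous map through which the coordinates of the source are fractions in those of the
target is inducing. -/
lemma IsZariski.isInducing_of_fraction {α : X → σ → k} {γ : Y → τ → k} (hα : IsZariski α)
    (hγ : IsZariski γ) {f : X → Y} (hf : Continuous f) {q : X → k}
    (hq : q ∈ regularFunctions fun x => γ (f x)) (hq0 : ∀ x, q x ≠ 0)
    (h : ∀ i, (fun x => α x i * q x) ∈ regularFunctions fun x => γ (f x)) :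
    IsInducing f := by
  refine ⟨le_antisymm hf.le_induced ?_⟩
  have hi : @IsZariski k _ τ X (.induced f inferInstance) fun x => γ (f x) := by
    let t : TopologicalSpace X := .induced f inferInstance
    exact hγ.comp ⟨rfl⟩
  exact continuous_id_iff_le.1
    (@IsZariski.continuous_of_fraction k _ τ σ X X (.induced f inferInstance) _ _ _ hi hα id q hq
      hq0 h)

/-- The affine space with coordinates indexed by `σ`, with its Zariski topology. -/
def Aff (k : Type*) (σ : Type*) : Type _ := σ → k

namespace Aff

noncomputable instance : TopologicalSpace (Aff k σ) :=
  TopologicalSpace.induced (fun x : σ → k => MvPolynomial.pointToPoint (k := k) x) inferInstance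

lemma isZariski : IsZariski (fun x : Aff k σ => (x : σ → k)) := ⟨rfl⟩

end Aff

lemma isPrime_vanishingIdeal_image {β : X → σ → k} (h : IsZariski β) {Z : Set X}
    (hZ : IsIrreducible Z) : (vanishingIdeal k (β '' Z)).IsPrime := by
  rw [← vanishingIdeal_pointToPoint]
  rw [← PrimeSpectrum.isIrreducible_iff_vanishingIdeal_isPrime, Set.image_image]
  exact hZ.image _ (IsInducing.continuous h).continuousOn

lemma preimage_zeroLocus_vanishingIdeal_image {β : X → σ → k} (h : IsZariski β) {Z : Set X}
    (hZ : IsClosed Z) : β ⁻¹' MvPolynomial.zeroLocus k (vanishingIdeal k (β '' Z)) = Z := by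
  refine subset_antisymm ?_ fun x hx =>
    zeroLocus_vanishingIdeal_le (k := k) (β '' Z) (Set.mem_image_of_mem β hx)
  obtain ⟨I, rfl⟩ := h.isClosed_iff.1 hZ
  refine Set.preimage_mono (zeroLocus_anti_mono ?_)
  rintro p hp _ ⟨x, hx, rfl⟩
  exact hx p hp

/-! ### Dimension through the Nullstellensatz -/

section Dimension

variable [IsAlgClosed k]

lemma isIrreducible_preimage_zeroLocus [Finite σ] {β : X → σ → k} (h : IsZariski β)
    {P : Ideal (MvPolynomial σ k)} [P.IsPrime]
    (hP : MvPolynomial.zeroLocus k P ⊆ Set.range β) :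
    IsIrreducible (β ⁻¹' MvPolynomial.zeroLocus k P) := by
  constructor
  · by_contra hne
    rw [Set.not_nonempty_iff_eq_empty] at hne
    have h0 : MvPolynomial.zeroLocus k P = ∅ := by
      rw [← Set.image_preimage_eq_of_subset hP, hne, Set.image_empty]
    have := MvPolynomial.IsPrime.vanishingIdeal_zeroLocus (K := k) P
    rw [h0, vanishingIdeal_empty] at this
    exact Ideal.IsPrime.ne_top ‹_› this.symm
  · rw [isPreirreducible_iff_isClosed_union_isClosed]
    intro Z₁ Z₂ h₁ h₂ hZ
    obtain ⟨I₁, rfl⟩ := h.isClosed_iff.1 h₁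
    obtain ⟨I₂, rfl⟩ := h.isClosed_iff.1 h₂
    have hsub : MvPolynomial.zeroLocus k P ⊆
        MvPolynomial.zeroLocus k I₁ ∪ MvPolynomial.zeroLocus k I₂ := by
      intro y hy
      obtain ⟨x, rfl⟩ := hP hy
      exact hZ hy
    -- By the Nullstellensatz the prime `P` consists of all polynomials vanishing on its zero locus,
    -- so covering by two closed sets becomes a statement about a product of ideals.
    have hmul : I₁ * I₂ ≤ P := by
      rw [← MvPolynomial.IsPrime.vanishingIdeal_zeroLocus (K := k) P, Ideal.mul_le]
      intro a ha b hb y hy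
      rcases hsub hy with h | h
      · rw [map_mul, h a ha, zero_mul]
      · rw [map_mul, h b hb, mul_zero]
    rcases (Ideal.IsPrime.mul_le ‹_›).1 hmul with h | h
    · exact Or.inl (Set.preimage_mono (zeroLocus_anti_mono h))
    · exact Or.inr (Set.preimage_mono (zeroLocus_anti_mono h))

/-- Irreducible closed subsets of `X` correspond, with order reversed, to the primes containing `I`.
Injectivity of `β` is not needed: points with equal coordinates lie in the same closed sets. -/
theorem IsZariski.topologicalKrullDim_eq [Finite σ] {β : X → σ → k} (h : IsZariski β)
    {I : Ideal (MvPolynomial σ k)} (hI : Set.range β = MvPolynomial.zeroLocus k I) :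
    topologicalKrullDim X = ringKrullDim (MvPolynomial σ k ⧸ I) := by
  rw [ringKrullDim_quotient, ← Order.krullDim_orderDual]
  apply le_antisymm
  · refine Order.krullDim_le_of_strictMono (fun Z : IrreducibleCloseds X => OrderDual.toDual
      (⟨⟨vanishingIdeal k (β '' Z), isPrime_vanishingIdeal_image h Z.isIrreducible⟩, ?_⟩ :
        PrimeSpectrum.zeroLocus (I : Set (MvPolynomial σ k)))) ?_
    · rintro p hp _ ⟨x, -, rfl⟩
      exact (hI ▸ Set.mem_range_self x : β x ∈ MvPolynomial.zeroLocus k I) p hp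
    · refine Monotone.strictMono_of_injective (fun Z₁ Z₂ hZ => ?_) fun Z₁ Z₂ hZ => ?_
      · exact vanishingIdeal_anti_mono (Set.image_mono hZ)
      · apply IrreducibleCloseds.ext
        rw [← preimage_zeroLocus_vanishingIdeal_image h Z₁.isClosed,
          ← preimage_zeroLocus_vanishingIdeal_image h Z₂.isClosed]
        have h2 : vanishingIdeal k (β '' Z₁) = vanishingIdeal k (β '' Z₂) :=
          congrArg (fun P => (OrderDual.ofDual P).1.asIdeal) hZ
        rw [h2]
  · have hP : ∀ P : PrimeSpectrum.zeroLocus (I : Set (MvPolynomial σ k)),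
        MvPolynomial.zeroLocus k P.1.asIdeal ⊆ Set.range β := fun P => by
      rw [hI]; exact zeroLocus_anti_mono P.2
    refine Order.krullDim_le_of_strictMono
      (fun P : (PrimeSpectrum.zeroLocus (I : Set (MvPolynomial σ k)))ᵒᵈ =>
        (⟨β ⁻¹' MvPolynomial.zeroLocus k (OrderDual.ofDual P).1.asIdeal,
          isIrreducible_preimage_zeroLocus h (hP _), h.isClosed_iff.2 ⟨_, rfl⟩⟩ :
          IrreducibleCloseds X)) ?_
    refine Monotone.strictMono_of_injective (fun P Q hPQ => ?_) fun P Q hPQ => ?_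
    · exact fun x hx => zeroLocus_anti_mono (K := k) hPQ hx
    · have h1 : MvPolynomial.zeroLocus k (OrderDual.ofDual P).1.asIdeal =
          MvPolynomial.zeroLocus k (OrderDual.ofDual Q).1.asIdeal := by
        rw [← Set.image_preimage_eq_of_subset (hP (OrderDual.ofDual P)),
          ← Set.image_preimage_eq_of_subset (hP (OrderDual.ofDual Q))]
        exact congrArg (β '' ·) (congrArg IrreducibleCloseds.carrier hPQ)
      have h2 := congrArg (vanishingIdeal k) h1
      rw [MvPolynomial.IsPrime.vanishingIdeal_zeroLocus,
        MvPolynomial.IsPrime.vanishingIdeal_zeroLocus] at h2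
      exact Subtype.ext (PrimeSpectrum.ext h2)

lemma ringKrullDim_mvPolynomial_quotient {R : Type*} [CommRing R] [IsNoetherianRing R] [Finite ρ]
    (I : Ideal R) : ringKrullDim (MvPolynomial ρ R ⧸ I.map (MvPolynomial.C (σ := ρ))) =
      ringKrullDim (R ⧸ I) + Nat.card ρ := by
  rw [← MvPolynomial.ringKrullDim_of_isNoetherianRing]
  exact (ringKrullDim_eq_of_ringEquiv (quotientEquivQuotientMvPolynomial I).toRingEquiv).symm

/-- `dim (𝔸^ρ × X) = dim X + #ρ` for `X` closed in affine space. -/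
theorem IsZariski.topologicalKrullDim_prod [Finite σ] [Finite ρ] {β : X → σ → k}
    (hβ : IsZariski β) {γ : Y → ρ ⊕ σ → k} (hγ : IsZariski γ) {I : Ideal (MvPolynomial σ k)}
    (hI : Set.range β = MvPolynomial.zeroLocus k I)
    (hY : ∀ p : ρ ⊕ σ → k, p ∈ Set.range γ ↔ (p ∘ Sum.inr) ∈ Set.range β) :
    topologicalKrullDim Y = topologicalKrullDim X + Nat.card ρ := by
  let J : Ideal (MvPolynomial ρ (MvPolynomial σ k)) := I.map MvPolynomial.C
  let e := sumAlgEquiv k ρ σ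
  -- The extension of `I` to the larger polynomial ring is generated by the members of `I` read in
  -- the variables `σ`, so its zero locus constrains only those coordinates.
  have hJ : Set.range γ = MvPolynomial.zeroLocus k (J.map (e.symm : MvPolynomial ρ (MvPolynomial σ k) →+* MvPolynomial (ρ ⊕ σ) k)) := by
    have : J.map (e.symm : MvPolynomial ρ (MvPolynomial σ k) →+* MvPolynomial (ρ ⊕ σ) k)
        = Ideal.span ((rename Sum.inr : MvPolynomial σ k →ₐ[k] _) '' I) := by
      rw [Ideal.map_map, Ideal.map]
      congr 1
      refine Set.image_congr fun p _ => ?_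
      simp only [RingHom.comp_apply, RingHom.coe_coe, e]
      rw [AlgEquiv.symm_apply_eq]
      exact (DFunLike.congr_fun (sumAlgEquiv_comp_rename_inr k ρ σ) p).symm
    rw [this, MvPolynomial.zeroLocus_span]
    ext p
    rw [hY, hI]
    change _ ↔ ∀ q ∈ (rename Sum.inr : MvPolynomial σ k →ₐ[k] _) '' I, aeval p q = 0
    simp only [Set.forall_mem_image, aeval_rename]
    rfl
  rw [hγ.topologicalKrullDim_eq hJ, hβ.topologicalKrullDim_eq hI,
    ← ringKrullDim_mvPolynomial_quotient]
  exact (ringKrullDim_eq_of_ringEquiv (Ideal.quotientEquiv J _ e.symm.toRingEquiv rfl)).symm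

end Dimension

end Zariski

/-! ### Matrices with regular entries -/

section RegularMatrices

variable {k : Type*} [Field k] {σ τ : Type*} {X : Type*} {m n l : Type*}

/-- The entries of the matrix-valued function `M` are polynomials in the coordinates `β`. -/
def IsRegularMatrix (β : X → σ → k) (M : X → Matrix m n k) : Prop :=
  ∀ i j, (fun x => M x i j) ∈ regularFunctions β

lemma isRegularMatrix_const (β : X → σ → k) (M : Matrix m n k) :
    IsRegularMatrix β fun _ => M :=
  fun _ _ => const_mem_regularFunctions β _

lemma sum_mem_regularFunctions {ι : Type*} {β : X → σ → k} {s : Finset ι} {f : ι → X → k}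
    (h : ∀ i, f i ∈ regularFunctions β) : (fun x => ∑ i ∈ s, f i x) ∈ regularFunctions β := by
  rw [← Finset.sum_fn]
  exact sum_mem fun i _ => h i

lemma IsRegularMatrix.mul [Fintype n] {β : X → σ → k} {M : X → Matrix m n k}
    {M' : X → Matrix n l k} (h : IsRegularMatrix β M) (h' : IsRegularMatrix β M') :
    IsRegularMatrix β fun x => M x * M' x := fun i j =>
  sum_mem_regularFunctions fun a => mul_mem (h i a) (h' a j)

lemma IsRegularMatrix.det [Fintype n] [DecidableEq n] {β : X → σ → k} {M : X → Matrix n n k}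
    (h : IsRegularMatrix β M) : (fun x => (M x).det) ∈ regularFunctions β := by
  simp only [Matrix.det_apply]
  refine sum_mem_regularFunctions fun g => ?_
  have : (fun x => Equiv.Perm.sign g • ∏ i, M x (g i) i) =
      Equiv.Perm.sign g • ∏ i, fun x => M x (g i) i := by
    funext x; simp
  rw [this]
  have hp : ∏ i, (fun x => M x (g i) i) ∈ regularFunctions β := prod_mem fun i _ => h _ _
  rcases Int.units_eq_one_or (Equiv.Perm.sign g) with hg | hg <;> rw [hg]
  · simpa using hp
  · simpa using neg_mem hp

lemma IsRegularMatrix.adjugate [Fintype n] [DecidableEq n] {β : X → σ → k} {M : X → Matrix n n k}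
    (h : IsRegularMatrix β M) : IsRegularMatrix β fun x => (M x).adjugate := by
  intro i j
  simp only [Matrix.adjugate_apply]
  refine IsRegularMatrix.det fun a b => ?_
  simp only [Matrix.updateRow_apply]
  by_cases ha : a = j
  · simpa [ha] using const_mem_regularFunctions β _
  · simpa [ha] using h a b

/-- A family of coordinates is Zariski if it is related to another one by fractions. -/
lemma IsZariski.of_fractions [TopologicalSpace X] {α : X → σ → k} (hα : IsZariski α)
    {γ : X → τ → k} {q q' : X → k} (hq : q ∈ regularFunctions α) (hq0 : ∀ x, q x ≠ 0)
    (hγ : ∀ j, (fun x => γ x j * q x) ∈ regularFunctions α)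
    (hq' : q' ∈ regularFunctions γ) (hq0' : ∀ x, q' x ≠ 0)
    (hα' : ∀ i, (fun x => α x i * q' x) ∈ regularFunctions γ) : IsZariski γ := by
  let f : X → Aff k τ := γ
  have hf : Continuous f := hα.continuous_of_fraction Aff.isZariski hq hq0 hγ
  exact Aff.isZariski.comp (hα.isInducing_of_fraction Aff.isZariski hf hq' hq0' hα')

end RegularMatrices

/-! ### Products with affine space and their open subsets -/

section Translation

variable {k : Type*} [Field k] {σ ρ : Type*} {X O : Type*}

/-- The preimages of `O` under the maps `T i` form an open cover, and `T i` embeds each of them in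
`O` topologically. This bounds the dimension of `Y` by that of `O` even when `Y` is reducible. -/
lemma topologicalKrullDim_le_of_translates {Y : Type*} [TopologicalSpace Y] {ι : Type*}
    {T : ι → Y → Y} (hT : ∀ i, IsInducing (T i)) {O : Set Y} (hO : IsOpen O)
    (h : ∀ y, ∃ i, T i y ∈ O) : topologicalKrullDim Y ≤ topologicalKrullDim O := by
  refine le_of_forall_natCast fun n hn => ?_
  obtain ⟨i, hi⟩ := exists_le_topologicalKrullDim_of_open_cover
    (fun i => hO.preimage (hT i).continuous) h hn
  exact hi.trans ((hT i).restrictPreimage O).topologicalKrullDim_le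

/-- The product of the affine space indexed by `ρ` with the image of `β`. -/
def cylinder (ρ : Type*) (β : X → σ → k) : Set (Aff k (ρ ⊕ σ)) :=
  {p | (fun i => p (Sum.inr i)) ∈ Set.range β}

/-- Translation of the cylinder along its affine factor. -/
def cylinder.translate {β : X → σ → k} (w : ρ → k) (p : cylinder ρ β) : cylinder ρ β :=
  ⟨fun i => p.1 i + Sum.elim w 0 i, by
    change (fun i => p.1 (Sum.inr i) + 0) ∈ Set.range β
    simp only [add_zero]
    exact p.2⟩

lemma cylinder.isZariski {β : X → σ → k} :
    IsZariski fun p : cylinder ρ β => (p.1 : ρ ⊕ σ → k) :=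
  Aff.isZariski.comp IsInducing.subtypeVal

lemma cylinder.isInducing_translate {β : X → σ → k} (w : ρ → k) :
    IsInducing (cylinder.translate (β := β) w) := by
  have hc : ∀ w : ρ → k, Continuous (cylinder.translate (β := β) w) := fun w =>
    cylinder.isZariski.continuous_of_regular cylinder.isZariski fun j =>
      add_mem (coord_mem_regularFunctions _ j) (const_mem_regularFunctions _ _)
  refine IsInducing.of_comp (hc w) (hc (-w)) ?_
  have : cylinder.translate (β := β) (-w) ∘ cylinder.translate w = id := by
    funext p
    refine Subtype.ext (funext fun i => ?_)
    cases i <;> simp [cylinder.translate]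
  rw [this]
  exact IsInducing.id

variable [IsAlgClosed k]

theorem topologicalKrullDim_aff [Finite ρ] : topologicalKrullDim (Aff k ρ) = Nat.card ρ := by
  rw [Aff.isZariski.topologicalKrullDim_eq (I := ⊥) 
    ((Set.range_eq_univ.2 fun x => ⟨x, rfl⟩).trans (MvPolynomial.zeroLocus_bot (K := k)).symm)]
  rw [ringKrullDim_eq_of_ringEquiv (RingEquiv.quotientBot (MvPolynomial ρ k)),
    MvPolynomial.ringKrullDim_of_isNoetherianRing, ringKrullDim_eq_zero_of_field, zero_add]

variable [TopologicalSpace X] [TopologicalSpace O]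

theorem topologicalKrullDim_cylinder [Finite σ] [Finite ρ] {β : X → σ → k} (hβ : IsZariski β)
    {I : Ideal (MvPolynomial σ k)} (hI : Set.range β = MvPolynomial.zeroLocus k I) :
    topologicalKrullDim (cylinder ρ β) = topologicalKrullDim X + Nat.card ρ := by
  refine hβ.topologicalKrullDim_prod cylinder.isZariski hI fun p => ?_
  constructor
  · rintro ⟨p, rfl⟩; exact p.2
  · exact fun h => ⟨⟨p, h⟩, rfl⟩

theorem IsZariski.topologicalKrullDim_le_add_card [Finite σ] [Finite ρ] {β : X → σ → k}
    (hβ : IsZariski β) {I : Ideal (MvPolynomial σ k)}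
    (hI : Set.range β = MvPolynomial.zeroLocus k I) {γ : O → ρ ⊕ σ → k} (hγ : IsZariski γ)
    (h : ∀ x, (fun i => γ x (Sum.inr i)) ∈ Set.range β) :
    topologicalKrullDim O ≤ topologicalKrullDim X + Nat.card ρ := by
  rw [← topologicalKrullDim_cylinder hβ hI]
  let f : O → cylinder ρ β := fun x => ⟨γ x, h x⟩
  have hf : IsInducing f := (IsInducing.of_comp_iff cylinder.isZariski).1 hγ
  exact hf.topologicalKrullDim_le

/-- A space that embeds in the product of `X` with an affine space as an open subset whose
translates along the affine space cover the product has at least the dimension of the product. -/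
theorem IsZariski.add_card_le_topologicalKrullDim [Finite σ] [Finite ρ] {β : X → σ → k}
    (hβ : IsZariski β) {I : Ideal (MvPolynomial σ k)}
    (hI : Set.range β = MvPolynomial.zeroLocus k I) {γ : O → ρ ⊕ σ → k} (hγ : IsZariski γ)
    (hinj : Function.Injective γ) {R : Set (Aff k (ρ ⊕ σ))} (hR : IsOpen R)
    (hrange : ∀ p, p ∈ Set.range γ ↔ (fun i => p (Sum.inr i)) ∈ Set.range β ∧ p ∈ R)
    (hcover : ∀ (v : ρ → k) (x : X), ∃ w, Sum.elim (v + w) (β x) ∈ R) :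
    topologicalKrullDim X + Nat.card ρ ≤ topologicalKrullDim O := by
  rw [← topologicalKrullDim_cylinder hβ hI]
  let f : O → cylinder ρ β := fun x => ⟨γ x, ((hrange (γ x)).1 ⟨x, rfl⟩).1⟩
  have hf : IsEmbedding f :=
    ⟨(IsInducing.of_comp_iff cylinder.isZariski).1 hγ,
      fun x y h => hinj (congrArg (fun p => (p.1 : ρ ⊕ σ → k)) h)⟩
  have hfr : Set.range f = (↑) ⁻¹' R := by
    ext p
    constructor
    · rintro ⟨x, rfl⟩; exact ((hrange (γ x)).1 ⟨x, rfl⟩).2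
    · intro hp
      obtain ⟨x, hx⟩ := (hrange p.1).2 ⟨p.2, hp⟩
      exact ⟨x, Subtype.ext hx⟩
  have hle := topologicalKrullDim_le_of_translates (cylinder.isInducing_translate (β := β))
    (hfr ▸ hR.preimage continuous_subtype_val : IsOpen (Set.range f)) fun p => by
      obtain ⟨x, hx⟩ := p.2
      obtain ⟨w, hw⟩ := hcover (fun i => p.1 (Sum.inl i)) x
      refine ⟨w, ?_⟩
      rw [hfr]
      change (cylinder.translate w p).1 ∈ R
      have : (cylinder.translate w p).1 = Sum.elim ((fun i => p.1 (Sum.inl i)) + w) (β x) := by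
        funext i
        cases i with
        | inl i => rfl
        | inr i => exact (add_zero _).trans (congrFun hx i).symm
      rwa [this]
  exact hle.trans hf.toHomeomorph.symm.isInducing.topologicalKrullDim_le

end Translation

/-! ### Frames, their spans and the action of invertible matrices -/

section Frames

variable {k : Type*} [Field k] {N r : ℕ}

lemma exists_mul_eq_one_of_linearIndependent {ι κ : Type*} [Fintype ι] [Fintype κ]
    [DecidableEq ι] [DecidableEq κ] {M : Matrix ι κ k}
    (h : LinearIndependent k M.row) : ∃ L : Matrix κ ι k, M * L = 1 := by
  have hinj : Function.Injective M.vecMulLinear := Matrix.vecMul_injective_iff.2 h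
  obtain ⟨φ, hφ⟩ := M.vecMulLinear.exists_leftInverse_of_injective (LinearMap.ker_eq_bot.2 hinj)
  refine ⟨LinearMap.toMatrixRight' φ, ?_⟩
  have h1 : LinearMap.toMatrixRight' M.vecMulLinear = M := LinearMap.toMatrixRight'.right_inv M
  conv_lhs => rw [← h1]
  rw [← LinearMap.toMatrixRight'_comp, hφ, LinearMap.toMatrixRight'_id]

lemma linearIndependent_row_of_det_ne_zero {ι κ : Type*} [Fintype ι] [Fintype κ] [DecidableEq ι]
    {M : Matrix ι κ k} {L : Matrix κ ι k} (h : (M * L).det ≠ 0) : LinearIndependent k M.row := by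
  rw [← Matrix.vecMul_injective_iff]
  have hu := Matrix.vecMul_injective_iff_isUnit.2
    ((Matrix.isUnit_iff_isUnit_det _).2 (isUnit_iff_ne_zero.2 h))
  intro v w hvw
  apply hu
  change Matrix.vecMul v M = Matrix.vecMul w M at hvw
  change Matrix.vecMul v (M * L) = Matrix.vecMul w (M * L)
  rw [← Matrix.vecMul_vecMul, hvw, Matrix.vecMul_vecMul]

namespace Frame

/-- The matrix whose rows are the vectors of the frame. -/
def mat (A : Frame k N r) : Matrix (Fin r) (Fin N) k := Matrix.of A.1

lemma mat_injective : Function.Injective (mat : Frame k N r → _) :=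
  fun _ _ h => Subtype.ext h

lemma linearIndependent_row_mat (A : Frame k N r) : LinearIndependent k A.mat.row := A.2

lemma exists_mat_mul_eq_one (A : Frame k N r) :
    ∃ L : Matrix (Fin N) (Fin r) k, A.mat * L = 1 :=
  exists_mul_eq_one_of_linearIndependent A.linearIndependent_row_mat

/-- The frame of the rows of a matrix `M` such that `M * L` is invertible. -/
def ofMatrix (M : Matrix (Fin r) (Fin N) k) (L : Matrix (Fin N) (Fin r) k)
    (h : (M * L).det ≠ 0) : Frame k N r :=
  ⟨fun i => M i, linearIndependent_row_of_det_ne_zero h⟩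

@[simp] lemma mat_ofMatrix (M : Matrix (Fin r) (Fin N) k) (L : Matrix (Fin N) (Fin r) k)
    (h : (M * L).det ≠ 0) : (ofMatrix M L h).mat = M := rfl

lemma linearIndependent_row_mul {g : Matrix (Fin r) (Fin r) k} (hg : g.det ≠ 0)
    (A : Frame k N r) : LinearIndependent k (g * A.mat).row := by
  obtain ⟨L, hL⟩ := A.exists_mat_mul_eq_one
  exact linearIndependent_row_of_det_ne_zero (L := L) (by rwa [Matrix.mul_assoc, hL, mul_one])

/-- The action of an invertible matrix on frames. -/
def act (g : Matrix (Fin r) (Fin r) k) (hg : g.det ≠ 0) (A : Frame k N r) : Frame k N r :=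
  ⟨fun i => (g * A.mat) i, linearIndependent_row_mul hg A⟩

@[simp] lemma mat_act (g : Matrix (Fin r) (Fin r) k) (hg : g.det ≠ 0) (A : Frame k N r) :
    (act g hg A).mat = g * A.mat := rfl

lemma span_le_span_iff {s : ℕ} (A : Frame k N r) (A' : Frame k N s) :
    A'.span.1 ≤ A.span.1 ↔ ∃ g : Matrix (Fin s) (Fin r) k, A'.mat = g * A.mat := by
  change Submodule.span k (Set.range A'.1) ≤ Submodule.span k (Set.range A.1) ↔ _
  rw [Submodule.span_le, Set.range_subset_iff]
  simp only [SetLike.mem_coe, Submodule.mem_span_range_iff_exists_fun]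
  constructor
  · intro h
    choose c hc using h
    refine ⟨Matrix.of c, ?_⟩
    ext i j
    rw [Matrix.mul_apply]
    have := congrFun (hc i) j
    simpa [mat] using this.symm
  · rintro ⟨g, hg⟩ i
    refine ⟨g i, ?_⟩
    funext j
    have := congrFun (congrFun hg i) j
    rw [Matrix.mul_apply] at this
    simpa [mat] using this.symm

lemma span_eq_span_iff {A A' : Frame k N r} :
    A.span = A'.span ↔ ∃ g : Matrix (Fin r) (Fin r) k, g.det ≠ 0 ∧ A'.mat = g * A.mat := by
  constructor
  · intro h
    obtain ⟨g, hg⟩ := (span_le_span_iff A A').1 (congrArg Subtype.val h).ge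
    obtain ⟨g', hg'⟩ := (span_le_span_iff A' A).1 (congrArg Subtype.val h).le
    refine ⟨g, ?_, hg⟩
    obtain ⟨L, hL⟩ := A.exists_mat_mul_eq_one
    -- The right inverse `L` of `A.mat` cancels it from `A.mat = g' * g * A.mat`.
    have h1 : g' * g = 1 := by
      rw [← hL]
      conv_rhs => rw [hg', hg]
      rw [Matrix.mul_assoc, Matrix.mul_assoc, hL, mul_one]
    intro h0
    have := congrArg Matrix.det h1
    simp [h0] at this
  · rintro ⟨g, hg, h⟩
    refine Subtype.ext (le_antisymm ((span_le_span_iff A' A).2 ⟨g⁻¹, ?_⟩)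
      ((span_le_span_iff A A').2 ⟨g, h⟩))
    rw [h, ← Matrix.mul_assoc, Matrix.nonsing_inv_mul _ (isUnit_iff_ne_zero.2 hg), Matrix.one_mul]

lemma isZariski_coords : IsZariski (coords : Frame k N r → Fin r × Fin N → k) := ⟨rfl⟩

lemma coords_injective : Function.Injective (coords : Frame k N r → Fin r × Fin N → k) :=
  fun _ _ h => Subtype.ext (funext fun i => funext fun j => congrFun h (i, j))

lemma isRegularMatrix_mat : IsRegularMatrix (coords : Frame k N r → _) mat :=
  fun i j => coord_mem_regularFunctions coords (i, j)

lemma span_surjective : Function.Surjective (span : Frame k N r → Gr k N r) := by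
  rintro ⟨W, hW⟩
  let b := Module.finBasisOfFinrankEq k W hW
  refine ⟨⟨fun i => (b i : Fin N → k), ?_⟩, Subtype.ext ?_⟩
  · exact b.linearIndependent.map' W.subtype W.ker_subtype
  · change Submodule.span k (Set.range (W.subtype ∘ b)) = W
    rw [Set.range_comp W.subtype b, Submodule.span_image, b.span_eq, Submodule.map_top,
      Submodule.range_subtype]

lemma isQuotientMap_span : IsQuotientMap (span : Frame k N r → Gr k N r) :=
  ⟨⟨rfl⟩, span_surjective⟩

lemma continuous_act (g : Matrix (Fin r) (Fin r) k) (hg : g.det ≠ 0) :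
    Continuous (act (N := N) g hg) :=
  isZariski_coords.continuous_of_regular isZariski_coords fun p =>
    (isRegularMatrix_const coords g).mul isRegularMatrix_mat p.1 p.2

/-- The fibres of `span` are the orbits of the invertible matrices, so the saturation of an open set
is a union of its translates. -/
lemma isOpenMap_span : IsOpenMap (span : Frame k N r → Gr k N r) := by
  intro U hU
  rw [← isQuotientMap_span.isOpen_preimage]
  have : span ⁻¹' (span '' U) =
      ⋃ g : {g : Matrix (Fin r) (Fin r) k // g.det ≠ 0}, act g.1 g.2 ⁻¹' U := by
    ext A
    simp only [Set.mem_preimage, Set.mem_image, Set.mem_iUnion]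
    constructor
    · rintro ⟨A', hA', h⟩
      obtain ⟨g, hg, hgA⟩ := span_eq_span_iff.1 h.symm
      refine ⟨⟨g, hg⟩, ?_⟩
      rwa [show act g hg A = A' from mat_injective hgA.symm]
    · rintro ⟨g, hg⟩
      exact ⟨_, hg, (span_eq_span_iff.2 ⟨g.1, g.2, rfl⟩).symm⟩
  rw [this]
  exact isOpen_iUnion fun g => hU.preimage (continuous_act _ _)

end Frame

end Frames

/-! ### Irreducibility of preimages under the span map -/

section IrreducibleFibers

variable {k : Type*} [Field k] [IsAlgClosed k] {N r : ℕ}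

instance {σ : Type*} [Finite σ] : IrreducibleSpace (Aff k σ) := by
  have h := isIrreducible_preimage_zeroLocus (Aff.isZariski (k := k) (σ := σ)) (P := ⊥)
    fun x _ => ⟨x, rfl⟩
  rw [MvPolynomial.zeroLocus_bot] at h
  exact { isPreirreducible_univ := h.2, toNonempty := ⟨h.1.some⟩ }

/-- A fibre is one orbit, the image of the invertible matrices, which form an open subset of an
irreducible affine space. -/
lemma Frame.isPreirreducible_fiber (W : Gr k N r) : IsPreirreducible (Frame.span ⁻¹' {W}) := by
  obtain ⟨A, rfl⟩ := Frame.span_surjective W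
  let M : Aff k (Fin r × Fin r) → Matrix (Fin r) (Fin r) k := fun p => Matrix.of fun i j => p (i, j)
  have hM : IsRegularMatrix (fun p : Aff k (Fin r × Fin r) => (p : Fin r × Fin r → k)) M :=
    fun i j => coord_mem_regularFunctions _ (i, j)
  let G : Set (Aff k (Fin r × Fin r)) := {p | (M p).det ≠ 0}
  have hG : IsOpen G := Aff.isZariski.isOpen_setOf_ne_zero hM.det
  have hGirr : IsPreirreducible G :=
    (PreirreducibleSpace.isPreirreducible_univ (X := Aff k (Fin r × Fin r))).open_subset hG
      (Set.subset_univ _)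
  have hGp : PreirreducibleSpace G := Subtype.preirreducibleSpace hGirr
  let f : G → Frame k N r := fun p => act (M p.1) p.2 A
  have hf : Continuous f :=
    (Aff.isZariski.comp IsInducing.subtypeVal).continuous_of_regular isZariski_coords fun p =>
      IsRegularMatrix.mul (fun i j => regularFunctions_comp _ (hM i j))
        (isRegularMatrix_const _ A.mat) p.1 p.2
  have hr : Frame.span ⁻¹' {A.span} = f '' Set.univ := by
    ext A'
    simp only [Set.mem_preimage, Set.mem_singleton_iff, Set.image_univ, Set.mem_range]
    rw [eq_comm, span_eq_span_iff]
    constructor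
    · rintro ⟨g, hg, h⟩
      exact ⟨⟨fun p => g p.1 p.2, hg⟩, mat_injective h.symm⟩
    · rintro ⟨p, rfl⟩
      exact ⟨M p.1, p.2, rfl⟩
  rw [hr]
  exact PreirreducibleSpace.isPreirreducible_univ.image _ hf.continuousOn

lemma Frame.isIrreducible_preimage_span {Z : Set (Gr k N r)} (hZ : IsIrreducible Z) :
    IsIrreducible (Frame.span ⁻¹' Z) :=
  hZ.preimage_of_isPreirreducible_fiber _ isOpenMap_span isPreirreducible_fiber
    (by simpa [span_surjective.range_eq] using hZ.nonempty)

end IrreducibleFibers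

/-! ### Charts of the frames and slices of the Grassmannian -/

section Charts

variable {k : Type*} [Field k] {N r : ℕ}

lemma regularFunctions_le {X σ τ : Type*} {β : X → σ → k} {γ : X → τ → k}
    (h : ∀ i, (fun x => β x i) ∈ regularFunctions γ) :
    regularFunctions β ≤ regularFunctions γ := by
  rw [regularFunctions, ← Algebra.adjoin_range_eq_range_aeval, Algebra.adjoin_le_iff]
  rintro _ ⟨i, rfl⟩
  exact h i

namespace Frame

variable (L : Matrix (Fin N) (Fin r) k)

/-- The frames that `L` maps to a basis of `k ^ r`. -/
def chart : Set (Frame k N r) := {A | (A.mat * L).det ≠ 0}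

lemma isOpen_chart : IsOpen (chart L) :=
  isZariski_coords.isOpen_setOf_ne_zero (isRegularMatrix_mat.mul (isRegularMatrix_const _ L)).det

lemma det_inv_ne_zero {L : Matrix (Fin N) (Fin r) k} {A : Frame k N r} (h : A ∈ chart L) :
    (A.mat * L)⁻¹.det ≠ 0 := by
  rw [Matrix.det_nonsing_inv, Ring.inverse_eq_inv']
  exact inv_ne_zero h

/-- The frame with the same span that `L` maps to the standard basis. -/
noncomputable def normalize (A : Frame k N r) (h : A ∈ chart L) : Frame k N r :=
  act (A.mat * L)⁻¹ (det_inv_ne_zero h) A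

variable {L}

lemma mat_normalize {A : Frame k N r} (h : A ∈ chart L) :
    (normalize L A h).mat = (A.mat * L)⁻¹ * A.mat := rfl

lemma mat_normalize_mul {A : Frame k N r} (h : A ∈ chart L) :
    (normalize L A h).mat * L = 1 := by
  rw [mat_normalize, Matrix.mul_assoc]
  exact Matrix.nonsing_inv_mul _ (isUnit_iff_ne_zero.2 h)

lemma mul_mat_normalize {A : Frame k N r} (h : A ∈ chart L) :
    (A.mat * L) * (normalize L A h).mat = A.mat := by
  rw [mat_normalize, ← Matrix.mul_assoc, Matrix.mul_nonsing_inv _ (isUnit_iff_ne_zero.2 h),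
    Matrix.one_mul]

lemma span_normalize {A : Frame k N r} (h : A ∈ chart L) : (normalize L A h).span = A.span :=
  (span_eq_span_iff.2 ⟨_, det_inv_ne_zero h, rfl⟩).symm

lemma det_mul_mat_normalize {A : Frame k N r} (h : A ∈ chart L) :
    (A.mat * L).det • (normalize L A h).mat = (A.mat * L).adjugate * A.mat := by
  rw [mat_normalize, Matrix.inv_def, Ring.inverse_eq_inv', Matrix.smul_mul, smul_smul,
    mul_inv_cancel₀ h, one_smul]

/-- If `A = g * s` and `s * L = 1`, then `A * L = g`, and normalizing removes `g`. Thus a slice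
meets each fibre of `span` at most once. -/
lemma eq_of_span_eq {A s : Frame k N r} (hs : s.mat * L = 1) (h : A.span = s.span) :
    ∃ hA : A ∈ chart L, normalize L A hA = s := by
  obtain ⟨g, hg, hgA⟩ := span_eq_span_iff.1 h.symm
  have hL : A.mat * L = g := by rw [hgA, Matrix.mul_assoc, hs, mul_one]
  refine ⟨by simpa [chart, hL] using hg, mat_injective ?_⟩
  rw [mat_normalize, hL, hgA, ← Matrix.mul_assoc,
    Matrix.nonsing_inv_mul _ (isUnit_iff_ne_zero.2 hg), Matrix.one_mul]

variable {O σ τ : Type*}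

lemma normalize_mul_det_mem {α : O → σ → k} {a : O → Frame k N r}
    (ha : IsRegularMatrix α fun x => (a x).mat) (hc : ∀ x, a x ∈ chart L) (p : Fin r × Fin N) :
    (fun x => (normalize L (a x) (hc x)).coords p * ((a x).mat * L).det) ∈ regularFunctions α := by
  have hr := ha.mul (isRegularMatrix_const α L)
  convert hr.adjugate.mul ha p.1 p.2 using 1
  funext x
  have := congrFun (congrFun (det_mul_mat_normalize (hc x)) p.1) p.2
  exact (mul_comm _ _).trans this

/-- Coordinates on a family of frames in a chart, with additional parameters `v`. -/
noncomputable def chartCoords (a : O → Frame k N r) (hc : ∀ x, a x ∈ chart L) (v : O → τ → k)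
    (x : O) : ((Fin r × Fin r) ⊕ τ) ⊕ (Fin r × Fin N) → k :=
  Sum.elim (Sum.elim (fun p => ((a x).mat * L) p.1 p.2) (v x)) (normalize L (a x) (hc x)).coords

lemma isRegularMatrix_chartCoords (a : O → Frame k N r) (hc : ∀ x, a x ∈ chart L)
    (v : O → τ → k) : IsRegularMatrix (chartCoords a hc v) fun x => (a x).mat := by
  have h₁ : IsRegularMatrix (chartCoords a hc v) fun x => (a x).mat * L :=
    fun i j => coord_mem_regularFunctions (chartCoords a hc v) (Sum.inl (Sum.inl (i, j)))
  have h₂ : IsRegularMatrix (chartCoords a hc v) fun x => (normalize L (a x) (hc x)).mat :=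
    fun i j => coord_mem_regularFunctions (chartCoords a hc v) (Sum.inr (i, j))
  have := h₁.mul h₂
  simpa only [mul_mat_normalize] using this

/-- Normalization is a fraction with denominator `det (A * L)` by Cramer's rule; conversely `A` is
the product of `A * L` and its normalization. The hypothesis `hα'` says that the frame and the
parameters `v` recover the original coordinates. -/
lemma isZariski_chartCoords [TopologicalSpace O] {α : O → σ → k} (hα : IsZariski α) {a : O → Frame k N r}
    (hc : ∀ x, a x ∈ chart L) {v : O → τ → k} (ha : IsRegularMatrix α fun x => (a x).mat)
    (hv : ∀ t, (fun x => v x t) ∈ regularFunctions α)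
    (hα' : ∀ i, (fun x => α x i) ∈ regularFunctions fun x => Sum.elim (a x).coords (v x)) :
    IsZariski (chartCoords a hc v) := by
  have hr := ha.mul (isRegularMatrix_const α L)
  refine hα.of_fractions (q' := fun _ => 1) hr.det hc ?_ (const_mem_regularFunctions _ _)
    (fun _ => one_ne_zero) ?_
  · rintro ((p | t) | p)
    · exact mul_mem (hr p.1 p.2) hr.det
    · exact mul_mem (hv t) hr.det
    · exact normalize_mul_det_mem ha hc p
  · intro i
    simp only [mul_one]
    refine regularFunctions_le ?_ (hα' i)
    rintro (p | t)
    · exact isRegularMatrix_chartCoords a hc v p.1 p.2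
    · exact coord_mem_regularFunctions (chartCoords a hc v) (Sum.inl (Sum.inr t))

variable (L)

lemma continuous_normalize : Continuous fun A : chart L => normalize L A.1 A.2 :=
  (isZariski_coords.comp IsInducing.subtypeVal).continuous_of_fraction isZariski_coords
    (IsRegularMatrix.mul (fun i j => regularFunctions_comp _ (isRegularMatrix_mat i j))
      (isRegularMatrix_const _ L)).det (fun A => A.2)
    (normalize_mul_det_mem (fun i j => regularFunctions_comp _ (isRegularMatrix_mat i j)) _)

/-- The frames over `Z` that `L` maps to the standard basis. -/
def slice (Z : Set (Gr k N r)) : Set (Frame k N r) := {A | A.mat * L = 1 ∧ A.span ∈ Z}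

lemma slice_mem_chart {Z : Set (Gr k N r)} (A : slice L Z) : A.1 ∈ chart L := by
  simp [chart, A.2.1]

/-- The map from a slice to the Grassmannian. -/
def sliceSpan (Z : Set (Gr k N r)) (A : slice L Z) : Z := ⟨A.1.span, A.2.2⟩

lemma isEmbedding_sliceSpan (Z : Set (Gr k N r)) : IsEmbedding (sliceSpan L Z) := by
  have hcont : Continuous (sliceSpan L Z) :=
    (isQuotientMap_span.continuous.comp continuous_subtype_val).subtype_mk _
  refine ⟨⟨le_antisymm hcont.le_induced fun U hU => ?_⟩, fun A A' h => ?_⟩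
  · obtain ⟨U', hU', rfl⟩ := isOpen_induced_iff.1 hU
    -- An open set of the slice is extended to the frames of the chart that normalize into it; this
    -- is open, and its image under the open map `span` has the required trace.
    refine isOpen_induced_iff.2 ⟨Subtype.val ⁻¹' (Frame.span '' (Subtype.val ''
      ((fun A : chart L => normalize L A.1 A.2) ⁻¹' U'))), ?_, ?_⟩
    · exact (isOpenMap_span _ ((isOpen_chart L).isOpenMap_subtype_val _
        (hU'.preimage (continuous_normalize L)))).preimage continuous_subtype_val
    · ext s
      constructor
      · rintro ⟨_, ⟨A, hA, rfl⟩, hs⟩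
        obtain ⟨hA', h⟩ := eq_of_span_eq s.2.1 hs
        change s.1 ∈ U'
        rw [← h]
        exact hA
      · intro hs
        obtain ⟨hA', h⟩ := eq_of_span_eq s.2.1 rfl
        exact ⟨s.1, ⟨⟨s.1, hA'⟩, by simpa [h] using hs, rfl⟩, rfl⟩
  · obtain ⟨h₁, h₂⟩ := eq_of_span_eq A'.2.1 (congrArg Subtype.val h)
    obtain ⟨h₃, h₄⟩ := eq_of_span_eq A.2.1 rfl
    exact Subtype.ext (h₄.symm.trans h₂)

lemma topologicalKrullDim_slice_le (Z : Set (Gr k N r)) :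
    topologicalKrullDim (slice L Z) ≤ topologicalKrullDim Z :=
  (isEmbedding_sliceSpan L Z).isInducing.topologicalKrullDim_le

/-- The spans of the charts cover `Z` by open sets, and normalization identifies each piece with a
slice. -/
lemma exists_le_topologicalKrullDim_slice {Z : Set (Gr k N r)} {n : ℕ}
    (h : (n : WithBot ℕ∞) ≤ topologicalKrullDim Z) :
    ∃ L, (n : WithBot ℕ∞) ≤ topologicalKrullDim (slice L Z) := by
  obtain ⟨L, hL⟩ := exists_le_topologicalKrullDim_of_open_cover
    (U := fun L => (Subtype.val ⁻¹' (span '' chart L) : Set Z))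
    (fun L => (isOpenMap_span _ (isOpen_chart L)).preimage continuous_subtype_val)
    (fun W => by
      obtain ⟨A, hA⟩ := span_surjective W.1
      obtain ⟨L, hL⟩ := A.exists_mat_mul_eq_one
      exact ⟨L, A, by simp [chart, hL], hA⟩) h
  refine ⟨L, hL.trans ?_⟩
  have hr : Set.range (sliceSpan L Z) = (Subtype.val ⁻¹' (span '' chart L) : Set Z) := by
    ext W
    constructor
    · rintro ⟨A, rfl⟩
      exact ⟨A.1, slice_mem_chart L A, rfl⟩
    · rintro ⟨A, hA, h⟩
      exact ⟨⟨normalize L A hA, mat_normalize_mul hA, by rw [span_normalize, h]; exact W.2⟩,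
        Subtype.ext ((span_normalize hA).trans h)⟩
  rw [← hr]
  exact (isEmbedding_sliceSpan L Z).toHomeomorph.symm.isInducing.topologicalKrullDim_le

lemma isZariski_slice (Z : Set (Gr k N r)) : IsZariski fun A : slice L Z => A.1.coords :=
  isZariski_coords.comp IsInducing.subtypeVal

/-- Frames are only open in affine space, but a matrix with `M * L = 1` has independent rows
automatically. So a slice over a closed set is closed among all matrices, as the Nullstellensatz
argument requires. -/
lemma exists_range_slice_eq_zeroLocus {Z : Set (Gr k N r)} (hZ : IsClosed Z) :
    ∃ I : Ideal (MvPolynomial (Fin r × Fin N) k), Set.range (fun A : slice L Z => A.1.coords) = MvPolynomial.zeroLocus k I := by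
  obtain ⟨J, hJ⟩ := isZariski_coords.isClosed_iff.1 (hZ.preimage isQuotientMap_span.continuous)
  let M : Aff k (Fin r × Fin N) → Matrix (Fin r) (Fin N) k := fun p => Matrix.of fun i j => p (i, j)
  have hM : IsRegularMatrix (fun p : Aff k (Fin r × Fin N) => (p : Fin r × Fin N → k)) M :=
    fun i j => coord_mem_regularFunctions _ (i, j)
  have hcl : IsClosed ({p : Aff k (Fin r × Fin N) | M p * L = 1} ∩
      {p | (p : Fin r × Fin N → k) ∈ MvPolynomial.zeroLocus k J}) := by
    refine IsClosed.inter ?_ (Aff.isZariski.isClosed_iff.2 ⟨J, rfl⟩)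
    have : {p : Aff k (Fin r × Fin N) | M p * L = 1} =
        ⋂ i, ⋂ j, {p | (M p * L) i j - (1 : Matrix (Fin r) (Fin r) k) i j = 0} := by
      ext p
      simp [← Matrix.ext_iff, sub_eq_zero]
    rw [this]
    exact isClosed_iInter fun i => isClosed_iInter fun j =>
      Aff.isZariski.isClosed_setOf_eq_zero (sub_mem (hM.mul (isRegularMatrix_const _ L) i j)
        (const_mem_regularFunctions _ _))
  obtain ⟨I, hI⟩ := Aff.isZariski.isClosed_iff.1 hcl
  refine ⟨I, Eq.trans ?_ hI⟩
  ext p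
  constructor
  · rintro ⟨A, rfl⟩
    exact ⟨A.2.1, (Set.ext_iff.1 hJ A.1).1 A.2.2⟩
  · rintro ⟨h₁, h₂⟩
    have hd : (M p * L).det ≠ 0 := by rw [show M p * L = 1 from h₁]; simp
    exact ⟨⟨ofMatrix (M p) L hd, h₁, (Set.ext_iff.1 hJ (ofMatrix (M p) L hd)).2 h₂⟩, rfl⟩

end Frame

end Charts

/-! ### Dimensions of frames, Grassmannians and sets over them -/

section Dimensions

variable {k : Type*} [Field k] {N r m : ℕ}

lemma IsZariski.isOpen_linearIndependent {X σ : Type*} [TopologicalSpace X] {β : X → σ → k}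
    (h : IsZariski β) {M : X → Matrix (Fin r) (Fin N) k} (hM : IsRegularMatrix β M) :
    IsOpen {x | LinearIndependent k (M x).row} := by
  have : {x | LinearIndependent k (M x).row} =
      ⋃ L : Matrix (Fin N) (Fin r) k, {x | (M x * L).det ≠ 0} := by
    ext x
    simp only [Set.mem_iUnion]
    constructor
    · intro hx
      obtain ⟨L, hL⟩ := exists_mul_eq_one_of_linearIndependent hx
      exact ⟨L, by simp [hL]⟩
    · rintro ⟨L, hL⟩
      exact linearIndependent_row_of_det_ne_zero hL
  rw [this]
  exact isOpen_iUnion fun L => h.isOpen_setOf_ne_zero (hM.mul (isRegularMatrix_const β L)).det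

namespace Frame

lemma exists_of_le (h : r ≤ N) : Nonempty (Frame k N r) :=
  ⟨⟨fun i => Pi.basisFun k (Fin N) (Fin.castLE h i),
    (Pi.basisFun k (Fin N)).linearIndependent.comp _ (Fin.castLE_injective h)⟩⟩

/-- The frame without its last vector. -/
def dropLast (A : Frame k N (m + 1)) : Frame k N m :=
  ⟨fun i => A.1 i.castSucc, A.2.comp _ (Fin.castSucc_injective m)⟩

lemma isRegularMatrix_mat_dropLast :
    IsRegularMatrix (coords : Frame k N (m + 1) → _) fun A => A.dropLast.mat :=
  fun i j => coord_mem_regularFunctions coords (i.castSucc, j)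

lemma continuous_dropLast : Continuous (dropLast : Frame k N (m + 1) → Frame k N m) :=
  isZariski_coords.continuous_of_regular isZariski_coords fun p => isRegularMatrix_mat_dropLast p.1 p.2

lemma linearIndependent_snoc_iff (A : Frame k N m) (v : Fin N → k) :
    LinearIndependent k (Fin.snoc A.1 v : Fin (m + 1) → Fin N → k) ↔ v ∉ A.span.1 :=
  linearIndependent_finSnoc.trans (and_iff_right A.2)

/-- The frame with one more vector. -/
def snoc (A : Frame k N m) (v : Fin N → k) (h : v ∉ A.span.1) : Frame k N (m + 1) :=
  ⟨Fin.snoc A.1 v, (linearIndependent_snoc_iff A v).2 h⟩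

@[simp] lemma dropLast_snoc (A : Frame k N m) (v : Fin N → k) (h : v ∉ A.span.1) :
    (A.snoc v h).dropLast = A :=
  Subtype.ext (funext fun i => Fin.snoc_castSucc (α := fun _ => Fin N → k) v A.1 i)

@[simp] lemma snoc_last (A : Frame k N m) (v : Fin N → k) (h : v ∉ A.span.1) :
    (A.snoc v h).1 (Fin.last m) = v :=
  Fin.snoc_last (α := fun _ => Fin N → k) v A.1

lemma last_notMem_span_dropLast (A : Frame k N (m + 1)) : A.1 (Fin.last m) ∉ A.dropLast.span.1 := by
  rw [← linearIndependent_snoc_iff]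
  have : (Fin.snoc A.dropLast.1 (A.1 (Fin.last m)) : Fin (m + 1) → Fin N → k) = A.1 :=
    Fin.snoc_init_self (α := fun _ => Fin N → k) A.1
  rw [this]
  exact A.2

lemma exists_notMem_span (A : Frame k N m) (h : m < N) : ∃ v, v ∉ A.span.1 := by
  by_contra! hv
  have h₁ : A.span.1 = ⊤ := Submodule.eq_top_iff'.2 hv
  have h₂ := A.span.2
  rw [h₁, finrank_top, Module.finrank_fin_fun] at h₂
  omega

variable [IsAlgClosed k]

theorem topologicalKrullDim_le :
    topologicalKrullDim (Frame k N r) ≤ ((r * N : ℕ) : WithBot ℕ∞) := by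
  let f : Frame k N r → Aff k (Fin r × Fin N) := coords
  have h : IsInducing f := (IsInducing.of_comp_iff Aff.isZariski).1 isZariski_coords
  simpa [topologicalKrullDim_aff] using h.topologicalKrullDim_le

theorem le_topologicalKrullDim (h : r ≤ N) :
    ((r * N : ℕ) : WithBot ℕ∞) ≤ topologicalKrullDim (Frame k N r) := by
  -- The base of the product is a point, with coordinates indexed by `Empty`; all entries of the
  -- frame are free coordinates.
  let γ : Frame k N r → (Fin r × Fin N) ⊕ Empty → k := fun A => Sum.elim A.coords Empty.elim
  have hreg : ∀ p, (fun A => γ A p) ∈ regularFunctions (coords : Frame k N r → _) := by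
    rintro (p | p)
    · exact coord_mem_regularFunctions _ p
    · exact p.elim
  have hγ : IsZariski γ := by
    refine isZariski_coords.of_fractions (q := fun _ => 1) (q' := fun _ => 1)
      (const_mem_regularFunctions _ _) (fun _ => one_ne_zero) ?_
      (const_mem_regularFunctions _ _) (fun _ => one_ne_zero) ?_
    · simpa using hreg
    · intro p
      simp only [mul_one]
      exact coord_mem_regularFunctions γ (Sum.inl p)
  let M : Aff k ((Fin r × Fin N) ⊕ Empty) → Matrix (Fin r) (Fin N) k :=
    fun p => Matrix.of fun i j => p (Sum.inl (i, j))
  have hM : IsRegularMatrix (fun p : Aff k ((Fin r × Fin N) ⊕ Empty) => (p : _ → k)) M :=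
    fun i j => coord_mem_regularFunctions _ _
  obtain ⟨A₀⟩ := exists_of_le (k := k) h
  have := (Aff.isZariski (k := k) (σ := Empty)).add_card_le_topologicalKrullDim (I := ⊥)
    ((Set.range_eq_univ.2 fun x => ⟨x, rfl⟩).trans (MvPolynomial.zeroLocus_bot (K := k)).symm)
    hγ (fun A A' h => coords_injective (funext fun p => congrFun h (Sum.inl p)))
    (Aff.isZariski.isOpen_linearIndependent hM) ?_ ?_
  · simpa [topologicalKrullDim_aff] using this
  · intro p
    constructor
    · rintro ⟨A, rfl⟩
      exact ⟨⟨Empty.elim, funext fun i => i.elim⟩, A.2⟩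
    · rintro ⟨-, hp⟩
      refine ⟨⟨_, hp⟩, funext fun i => ?_⟩
      rcases i with i | i
      · rfl
      · exact i.elim
  · intro v x
    -- Any matrix can be translated to the fixed frame `A₀`.
    refine ⟨A₀.coords - v, ?_⟩
    rw [add_sub_cancel]
    exact A₀.2

/-- The set of frames over `Z` has dimension at most `dim Z + r ^ 2`. -/
theorem topologicalKrullDim_preimage_span_le {Z : Set (Gr k N r)} (hZ : IsClosed Z) :
    topologicalKrullDim (Frame.span ⁻¹' Z) ≤ topologicalKrullDim Z + (r * r : ℕ) := by
  refine le_of_forall_natCast fun n hn => ?_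
  obtain ⟨L, hL⟩ := exists_le_topologicalKrullDim_of_open_cover
    (U := fun L => (Subtype.val ⁻¹' chart L : Set (Frame.span ⁻¹' Z)))
    (fun L => (isOpen_chart L).preimage continuous_subtype_val)
    (fun A => by
      obtain ⟨L, hL⟩ := A.1.exists_mat_mul_eq_one
      exact ⟨L, by simp [chart, hL]⟩) hn
  obtain ⟨I, hI⟩ := exists_range_slice_eq_zeroLocus L hZ
  let O : Set (Frame.span ⁻¹' Z) := Subtype.val ⁻¹' chart L
  have hα : IsZariski fun x : O => x.1.1.coords :=
    isZariski_coords.comp (IsInducing.subtypeVal.comp IsInducing.subtypeVal)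
  have hγ := isZariski_chartCoords (L := L) hα (a := fun x => x.1.1) (fun x => x.2)
    (v := fun _ => Empty.elim) (fun i j => coord_mem_regularFunctions _ (i, j))
    (fun t => t.elim) fun i => coord_mem_regularFunctions
      (fun x : O => Sum.elim x.1.1.coords Empty.elim) (Sum.inl i)
  refine hL.trans (((isZariski_slice L Z).topologicalKrullDim_le_add_card hI hγ
    fun x => ?_).trans ?_)
  · refine ⟨⟨normalize L x.1.1 x.2, mat_normalize_mul x.2, ?_⟩, rfl⟩
    rw [span_normalize]
    exact x.1.2
  · refine (add_le_add_left (topologicalKrullDim_slice_le L Z) _).trans (le_of_eq ?_)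
    simp

/-- The chart is the product of the invertible matrices with the slice, which is open in affine
space times the slice. It also lies in the space of frames, of dimension at most `r * N`. -/
lemma topologicalKrullDim_slice_add_le :
    ∀ L : Matrix (Fin N) (Fin r) k, topologicalKrullDim (slice L Set.univ) + (r * r : ℕ) ≤
      ((r * N : ℕ) : WithBot ℕ∞) := by
  intro L
  obtain ⟨I, hI⟩ := exists_range_slice_eq_zeroLocus L isClosed_univ
  have hα : IsZariski fun x : chart L => x.1.coords := isZariski_coords.comp IsInducing.subtypeVal
  have hγ := isZariski_chartCoords (L := L) hα (a := fun x => x.1) (fun x => x.2)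
    (v := fun _ => Empty.elim) (fun i j => coord_mem_regularFunctions _ (i, j))
    (fun t => t.elim) fun i => coord_mem_regularFunctions
      (fun x : chart L => Sum.elim x.1.coords Empty.elim) (Sum.inl i)
  let M : Aff k (((Fin r × Fin r) ⊕ Empty) ⊕ (Fin r × Fin N)) → Matrix (Fin r) (Fin r) k :=
    fun p => Matrix.of fun i j => p (Sum.inl (Sum.inl (i, j)))
  have hM : IsRegularMatrix (fun p : Aff k (((Fin r × Fin r) ⊕ Empty) ⊕ (Fin r × Fin N)) =>
    (p : _ → k)) M := fun i j => coord_mem_regularFunctions _ _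
  have := (isZariski_slice L Set.univ).add_card_le_topologicalKrullDim hI hγ ?_
    (Aff.isZariski.isOpen_setOf_ne_zero hM.det) ?_ ?_
  · refine le_trans (le_of_eq ?_) (this.trans
      ((topologicalKrullDim_subspace_le _ _).trans topologicalKrullDim_le))
    simp
  · intro A A' h
    refine Subtype.ext (mat_injective ?_)
    rw [← mul_mat_normalize A.2, ← mul_mat_normalize A'.2]
    congr 1
    · ext i j
      exact congrFun h (Sum.inl (Sum.inl (i, j)))
    · ext i j
      exact congrFun h (Sum.inr (i, j))
  · intro p
    constructor
    · rintro ⟨A, rfl⟩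
      exact ⟨⟨⟨normalize L A.1 A.2, mat_normalize_mul A.2, trivial⟩, rfl⟩, A.2⟩
    · rintro ⟨⟨s, hs⟩, hp⟩
      have h₁ : (act (M p) hp s.1).mat * L = M p := by
        rw [mat_act, Matrix.mul_assoc, s.2.1, mul_one]
      obtain ⟨hc, h₂⟩ := eq_of_span_eq (A := act (M p) hp s.1) s.2.1
        (span_eq_span_iff.2 ⟨M p, hp, rfl⟩).symm
      refine ⟨⟨act (M p) hp s.1, hc⟩, ?_⟩
      funext i
      rcases i with (⟨i, j⟩ | i) | i
      · exact congrFun (congrFun h₁ i) j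
      · exact i.elim
      · exact (congrFun (congrArg coords h₂) i).trans (congrFun hs i)
  · intro v x
    refine ⟨Sum.elim (fun p => (1 : Matrix (Fin r) (Fin r) k) p.1 p.2) Empty.elim - v, ?_⟩
    rw [add_sub_cancel]
    change Matrix.det (1 : Matrix (Fin r) (Fin r) k) ≠ 0
    simp

theorem _root_.Gr.topologicalKrullDim_add_le :
    topologicalKrullDim (Gr k N r) + (r * r : ℕ) ≤ ((r * N : ℕ) : WithBot ℕ∞) := by
  refine add_natCast_le_of_forall_natCast fun n hn => ?_
  have hu : (n : WithBot ℕ∞) ≤ topologicalKrullDim (Set.univ : Set (Gr k N r)) :=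
    hn.trans (Homeomorph.Set.univ _).symm.isInducing.topologicalKrullDim_le
  obtain ⟨L, hL⟩ := exists_le_topologicalKrullDim_slice hu
  refine le_trans ?_ (topologicalKrullDim_slice_add_le L)
  rw [Nat.cast_add]
  exact add_le_add_left hL _

theorem _root_.Gr.le_topologicalKrullDim_add (h : r ≤ N) :
    ((r * N : ℕ) : WithBot ℕ∞) ≤ topologicalKrullDim (Gr k N r) + (r * r : ℕ) := by
  have h₁ := topologicalKrullDim_preimage_span_le (k := k) (N := N) (r := r) isClosed_univ
  have h₂ : topologicalKrullDim (Frame k N r) ≤ _ :=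
    (Homeomorph.Set.univ (Frame k N r)).symm.isInducing.topologicalKrullDim_le
  exact (le_topologicalKrullDim h).trans (h₂.trans (h₁.trans
    (add_le_add_left (topologicalKrullDim_subspace_le _ _) _)))

/-- The dimension of the set of frames with one more vector over a slice. -/
theorem topologicalKrullDim_slice_add_le_preimage_dropLast {Z : Set (Gr k N m)} (hZ : IsClosed Z)
    (hm : m < N) (L : Matrix (Fin N) (Fin m) k) :
    topologicalKrullDim (slice L Z) + (m * m + N : ℕ) ≤
      topologicalKrullDim {A : Frame k N (m + 1) | A.dropLast.span ∈ Z} := by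
  obtain ⟨I, hI⟩ := exists_range_slice_eq_zeroLocus L hZ
  let O : Set {A : Frame k N (m + 1) | A.dropLast.span ∈ Z} := {A | A.1.dropLast ∈ chart L}
  have hα : IsZariski fun x : O => x.1.1.coords :=
    isZariski_coords.comp (IsInducing.subtypeVal.comp IsInducing.subtypeVal)
  have hα' : ∀ i, (fun x : O => x.1.1.coords i) ∈ regularFunctions
      fun x : O => Sum.elim x.1.1.dropLast.coords (x.1.1.1 (Fin.last m)) := by
    rintro ⟨i, j⟩
    induction i using Fin.lastCases with
    | last =>
      exact coord_mem_regularFunctions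
        (fun x : O => Sum.elim x.1.1.dropLast.coords (x.1.1.1 (Fin.last m))) (Sum.inr j)
    | cast i =>
      exact coord_mem_regularFunctions
        (fun x : O => Sum.elim x.1.1.dropLast.coords (x.1.1.1 (Fin.last m))) (Sum.inl (i, j))
  have hγ := isZariski_chartCoords (L := L) hα (a := fun x => x.1.1.dropLast) (fun x => x.2)
    (v := fun x => x.1.1.1 (Fin.last m))
    (fun i j => regularFunctions_comp (fun x : O => x.1.1) (isRegularMatrix_mat_dropLast i j))
    (fun t => coord_mem_regularFunctions (fun x : O => x.1.1.coords) (Fin.last m, t)) hα'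
  let T := ((Fin m × Fin m) ⊕ Fin N) ⊕ (Fin m × Fin N)
  let M : Aff k T → Matrix (Fin m) (Fin m) k :=
    fun p => Matrix.of fun i j => p (Sum.inl (Sum.inl (i, j)))
  let S : Aff k T → Matrix (Fin (m + 1)) (Fin N) k := fun p =>
    Matrix.of (Fin.snoc (fun i j => p (Sum.inr (i, j))) (fun j => p (Sum.inl (Sum.inr j))) :
      Fin (m + 1) → Fin N → k)
  have hM : IsRegularMatrix (fun p : Aff k T => (p : T → k)) M :=
    fun i j => coord_mem_regularFunctions _ _
  have hS : IsRegularMatrix (fun p : Aff k T => (p : T → k)) S := by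
    intro i j
    induction i using Fin.lastCases with
    | last =>
      simpa [S] using coord_mem_regularFunctions (fun p : Aff k T => (p : T → k))
        (Sum.inl (Sum.inr j))
    | cast i =>
      simpa [S] using coord_mem_regularFunctions (fun p : Aff k T => (p : T → k)) (Sum.inr (i, j))
  have := (isZariski_slice L Z).add_card_le_topologicalKrullDim hI hγ ?_
    ((Aff.isZariski.isOpen_setOf_ne_zero hM.det).inter
      (Aff.isZariski.isOpen_linearIndependent hS)) ?_ ?_
  -- The free coordinates are the `m * m` entries of the change of basis and the `N` entries of the
  -- last vector.
  · refine le_trans (le_of_eq ?_) (this.trans (topologicalKrullDim_subspace_le _ O))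
    simp
  · intro A A' h
    have h₁ : A.1.1.dropLast.mat = A'.1.1.dropLast.mat := by
      rw [← mul_mat_normalize A.2, ← mul_mat_normalize A'.2]
      congr 1
      · ext i j
        exact congrFun h (Sum.inl (Sum.inl (i, j)))
      · ext i j
        exact congrFun h (Sum.inr (i, j))
    refine Subtype.ext (Subtype.ext (mat_injective ?_))
    ext i j
    induction i using Fin.lastCases with
    | last => exact congrFun h (Sum.inl (Sum.inr j))
    | cast i => exact congrFun (congrFun h₁ i) j
  · intro p
    constructor
    · rintro ⟨A, rfl⟩
      refine ⟨⟨⟨normalize L A.1.1.dropLast A.2, mat_normalize_mul A.2, ?_⟩, rfl⟩, A.2, ?_⟩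
      · rw [span_normalize]
        exact A.1.2
      · refine (linearIndependent_snoc_iff (normalize L A.1.1.dropLast A.2) (A.1.1.1 (Fin.last m))).2 ?_
        rw [span_normalize]
        exact last_notMem_span_dropLast _
    · rintro ⟨⟨s, hs⟩, hp, hp'⟩
      have h₀ : (act (M p) hp s.1).span = s.1.span := (span_eq_span_iff.2 ⟨M p, hp, rfl⟩).symm
      have h₁ : (act (M p) hp s.1).mat * L = M p := by
        rw [mat_act, Matrix.mul_assoc, s.2.1, mul_one]
      obtain ⟨hc, h₂⟩ := eq_of_span_eq (A := act (M p) hp s.1) s.2.1 h₀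
      have hs' : s.1.1 = fun i j => p (Sum.inr (i, j)) :=
        funext fun i => funext fun j => congrFun hs (i, j)
      have hv : (fun j => p (Sum.inl (Sum.inr j))) ∉ (act (M p) hp s.1).span.1 := by
        rw [h₀, ← linearIndependent_snoc_iff, hs']
        exact hp'
      have hi := dropLast_snoc _ _ hv
      refine ⟨⟨⟨snoc _ _ hv, by
        change Frame.span (dropLast _) ∈ Z
        rw [hi, h₀]
        exact s.2.2⟩, by
        change dropLast _ ∈ chart L
        rwa [hi]⟩, ?_⟩
      funext i
      rcases i with (⟨i, j⟩ | i) | i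
      · change ((dropLast (snoc _ _ hv)).mat * L) i j = _
        rw [hi, h₁]
        rfl
      · exact congrFun (snoc_last _ _ hv) i
      · change (normalize L (dropLast (snoc _ _ hv)) _).coords i = _
        simp only [hi, h₂]
        exact congrFun hs i
  · intro v x
    obtain ⟨u, hu⟩ := x.1.exists_notMem_span hm
    -- Translate the change of basis to the identity and the last vector to some `u` outside the
    -- span; such a `u` exists because `m < N`.
    refine ⟨Sum.elim (fun p => (1 : Matrix (Fin m) (Fin m) k) p.1 p.2) u - v, ?_⟩
    rw [add_sub_cancel]
    constructor
    · change Matrix.det (1 : Matrix (Fin m) (Fin m) k) ≠ 0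
      simp
    · exact (linearIndependent_snoc_iff x.1 u).2 hu

end Frame

end Dimensions

/-! ### Incidence between subspaces of consecutive dimensions -/

section Incidence

variable {k : Type*} [Field k] {N m : ℕ}

namespace Frame

lemma span_le_span_snoc (A : Frame k N m) (v : Fin N → k) (h : v ∉ A.span.1) :
    A.span.1 ≤ (A.snoc v h).span.1 := by
  refine Submodule.span_le.2 ?_
  rintro _ ⟨i, rfl⟩
  have : A.1 i = (A.snoc v h).1 i.castSucc :=
    (Fin.snoc_castSucc (α := fun _ => Fin N → k) v A.1 i).symm
  rw [this]
  exact Submodule.subset_span ⟨_, rfl⟩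

lemma mem_span_snoc (A : Frame k N m) (v : Fin N → k) (h : v ∉ A.span.1) :
    v ∈ (A.snoc v h).span.1 :=
  Submodule.subset_span ⟨Fin.last m, snoc_last A v h⟩

lemma span_snoc_le (A : Frame k N m) (v : Fin N → k) (h : v ∉ A.span.1)
    {W : Submodule k (Fin N → k)} (hA : A.span.1 ≤ W) (hv : v ∈ W) :
    (A.snoc v h).span.1 ≤ W := by
  refine Submodule.span_le.2 ?_
  rintro _ ⟨i, rfl⟩
  induction i using Fin.lastCases with
  | last => rw [snoc_last]; exact hv
  | cast i =>
    have : (A.snoc v h).1 i.castSucc = A.1 i :=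
      Fin.snoc_castSucc (α := fun _ => Fin N → k) v A.1 i
    rw [this]
    exact hA (Submodule.subset_span ⟨i, rfl⟩)

lemma exists_span_snoc_eq (A : Frame k N m) (b : Gr k N (m + 1)) (h : A.span.1 ≤ b.1) :
    ∃ v, ∃ hv : v ∉ A.span.1, (A.snoc v hv).span = b := by
  have hlt : A.span.1 < b.1 := lt_of_le_of_ne h fun he => by
    have h₁ := A.span.2
    rw [he, b.2] at h₁
    omega
  obtain ⟨v, hvb, hv⟩ := SetLike.exists_of_lt hlt
  refine ⟨v, hv, Subtype.ext (Submodule.eq_of_le_of_finrank_eq (span_snoc_le A v hv h hvb) ?_)⟩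
  rw [(A.snoc v hv).span.2, b.2]

end Frame

namespace Gr

lemma exists_le_of_notMem (c : Gr k N m) {v : Fin N → k} (hv : v ∉ c.1) :
    ∃ b : Gr k N (m + 1), c.1 ≤ b.1 ∧ v ∈ b.1 ∧ ∀ W, c.1 ≤ W → v ∈ W → b.1 ≤ W := by
  obtain ⟨A, rfl⟩ := Frame.span_surjective c
  exact ⟨(A.snoc v hv).span, A.span_le_span_snoc v hv, A.mem_span_snoc v hv,
    fun _ => A.span_snoc_le v hv⟩

lemma exists_between {U W : Submodule k (Fin N → k)} (hUW : U ≤ W) :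
    ∀ d, Module.finrank k U ≤ d → d ≤ Module.finrank k W → ∃ c : Gr k N d, U ≤ c.1 ∧ c.1 ≤ W := by
  intro d hd
  induction d, hd using Nat.le_induction with
  | base => exact fun _ => ⟨⟨U, rfl⟩, le_rfl, hUW⟩
  | succ d _ ih =>
    intro hdW
    obtain ⟨c, hUc, hcW⟩ := ih (by omega)
    have hlt : c.1 < W := lt_of_le_of_ne hcW fun he => by
      have := c.2
      rw [he] at this
      omega
    obtain ⟨v, hvW, hv⟩ := SetLike.exists_of_lt hlt
    obtain ⟨b, hcb, -, hb⟩ := c.exists_le_of_notMem hv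
    exact ⟨b, hUc.trans hcb, hb W hcW hvW⟩

/-- A nonempty set of `(m + 1)`-dimensional subspaces that contains every neighbour of its members,
two subspaces being neighbours if they share an `m`-dimensional subspace, is everything. -/
lemma eq_univ_of_incidence {B : Set (Gr k N (m + 1))} {C : Set (Gr k N m)} (hB : B.Nonempty)
    (hCB : ∀ c ∈ C, ∀ b : Gr k N (m + 1), c.1 ≤ b.1 → b ∈ B)
    (hBC : ∀ b ∈ B, ∀ c : Gr k N m, c.1 ≤ b.1 → c ∈ C) : B = Set.univ := by
  refine Set.eq_univ_of_forall fun b' => ?_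
  -- Induction on a bound `d` for the codimension of `b ⊓ b'` in `b`; at `d = 0` the two subspaces
  -- coincide.
  have key : ∀ d, ∀ b ∈ B,
      m + 1 ≤ Module.finrank k (b.1 ⊓ b'.1 : Submodule k (Fin N → k)) + d → b' ∈ B := by
    intro d
    induction d with
    | zero =>
      intro b hb hd
      have h₁ : b.1 ⊓ b'.1 = b.1 :=
        Submodule.eq_of_le_of_finrank_le inf_le_left (by rw [b.2]; exact hd)
      have h₂ : b.1 ⊓ b'.1 = b'.1 :=
        Submodule.eq_of_le_of_finrank_le inf_le_right (by rw [b'.2]; exact hd)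
      rwa [show b' = b from Subtype.ext (h₂.symm.trans h₁)]
    | succ d ih =>
      intro b hb hd
      by_cases hle : b'.1 ≤ b.1
      · rwa [show b' = b from
          Subtype.ext (Submodule.eq_of_le_of_finrank_eq hle (by rw [b.2, b'.2]))]
      · obtain ⟨v, hvb', hvb⟩ := SetLike.not_le_iff_exists.1 hle
        have hlt : Module.finrank k (b.1 ⊓ b'.1 : Submodule k (Fin N → k)) < m + 1 := by
          refine lt_of_lt_of_eq (Submodule.finrank_lt_finrank_of_lt
            (lt_of_le_of_ne inf_le_right fun he => hle ?_)) b'.2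
          rw [← he]
          exact inf_le_left
        -- Move from `b` to its neighbour `b₁`, spanned by a hyperplane `c` of `b` containing `b ⊓
        -- b'` and a vector `v` of `b'` outside `b`. The intersection with `b'` grows.
        obtain ⟨c, hc, hcb⟩ := exists_between (inf_le_left : b.1 ⊓ b'.1 ≤ b.1) m (by omega)
          (by rw [b.2]; omega)
        obtain ⟨b₁, hcb₁, hvb₁, -⟩ := c.exists_le_of_notMem fun h => hvb (hcb h)
        refine ih b₁ (hCB c (hBC b hb c hcb) b₁ hcb₁) ?_
        have hlt' : b.1 ⊓ b'.1 < b₁.1 ⊓ b'.1 := by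
          refine lt_of_le_of_ne (le_inf (hc.trans hcb₁) inf_le_right) fun he => hvb ?_
          have : v ∈ b₁.1 ⊓ b'.1 := ⟨hvb₁, hvb'⟩
          rw [← he] at this
          exact this.1
        have := Submodule.finrank_lt_finrank_of_lt hlt'
        omega
  obtain ⟨b, hb⟩ := hB
  exact key (m + 1) b hb (by omega)

end Gr

variable [IsAlgClosed k]

/-- If `B` contains all subspaces that contain a member of `C`, then the same holds for the
closures of `B` and `C`. -/
lemma mem_closure_of_incidence {B : Set (Gr k N (m + 1))} {C : Set (Gr k N m)}
    (hCB : ∀ c ∈ C, ∀ b : Gr k N (m + 1), c.1 ≤ b.1 → b ∈ B) (hm : m < N) :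
    ∀ c ∈ closure C, ∀ b : Gr k N (m + 1), c.1 ≤ b.1 → b ∈ closure B := by
  obtain ⟨J, hJ⟩ := Frame.isZariski_coords.isClosed_iff.1
    (isClosed_closure.preimage Frame.isQuotientMap_span.continuous :
      IsClosed (Frame.span ⁻¹' closure B))
  -- `K` is the zero locus among all matrices of equations for the frames over `closure B`.
  -- Dependent rows are allowed, so that `f A v ∈ K` makes sense for every `v` and is a closed
  -- condition on `A` for fixed `v`, and on `v` for fixed `A`.
  let K : Set (Aff k (Fin (m + 1) × Fin N)) :=
    {p | (p : Fin (m + 1) × Fin N → k) ∈ MvPolynomial.zeroLocus k J}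
  have hK : IsClosed K := Aff.isZariski.isClosed_iff.2 ⟨J, rfl⟩
  let f : Frame k N m → Aff k (Fin N) → Aff k (Fin (m + 1) × Fin N) := fun A v p =>
    (Fin.snoc A.1 v : Fin (m + 1) → Fin N → k) p.1 p.2
  have hlast : ∀ A v j, f A v (Fin.last m, j) = v j := fun A v j =>
    congrFun (Fin.snoc_last (α := fun _ => Fin N → k) v A.1) j
  have hcast : ∀ A v i j, f A v (Fin.castSucc i, j) = A.1 i j := fun A v i j =>
    congrFun (Fin.snoc_castSucc (α := fun _ => Fin N → k) v A.1 i) j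
  have hf₁ : ∀ v, Continuous fun A => f A v := fun v =>
    Frame.isZariski_coords.continuous_of_regular Aff.isZariski fun ⟨i, j⟩ => by
      induction i using Fin.lastCases with
      | last =>
        simp only [hlast]
        exact const_mem_regularFunctions _ (v j)
      | cast i =>
        simp only [hcast]
        exact coord_mem_regularFunctions (Frame.coords (k := k)) (i, j)
  have hf₂ : ∀ A, IsRegularMatrix (fun v : Aff k (Fin N) => (v : Fin N → k))
      fun v => Matrix.of fun i j => f A v (i, j) := fun A i j => by
    induction i using Fin.lastCases with
    | last =>
      simp only [Matrix.of_apply, hlast]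
      exact coord_mem_regularFunctions (fun v : Aff k (Fin N) => (v : _ → k)) j
    | cast i =>
      simp only [Matrix.of_apply, hcast]
      exact const_mem_regularFunctions _ (A.1 i j)
  have hf₂' : ∀ A, Continuous (f A) := fun A =>
    Aff.isZariski.continuous_of_regular Aff.isZariski fun p => hf₂ A p.1 p.2
  have hmemK : ∀ (A : Frame k N m) (v) (hv : v ∉ A.span.1),
      f A v ∈ K ↔ (A.snoc v hv).span ∈ closure B := fun A v hv =>
    ((Set.ext_iff.1 hJ (A.snoc v hv)).symm : _)
  have hT : IsClosed {A : Frame k N m | ∀ v, f A v ∈ K} := by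
    simp only [Set.ofPred_forall]
    exact isClosed_iInter fun v => hK.preimage (hf₁ v)
  have hCT : Frame.span ⁻¹' C ⊆ {A : Frame k N m | ∀ v, f A v ∈ K} := by
    intro A hA
    have hU : IsOpen {v : Aff k (Fin N) | v ∉ A.span.1} := by
      have : {v : Aff k (Fin N) | v ∉ A.span.1} =
          {v | LinearIndependent k (Matrix.of fun i j => f A v (i, j)).row} :=
        Set.ext fun v => (Frame.linearIndependent_snoc_iff A v).symm
      rw [this]
      exact Aff.isZariski.isOpen_linearIndependent (hf₂ A)
    -- For `A` over `C`, membership in `K` is known only for `v` outside the span. These `v` form a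
    -- nonempty open, hence dense, subset of affine space, so it holds for all `v`.
    have hd := hU.dense (A.exists_notMem_span hm)
    have hsub : {v : Aff k (Fin N) | v ∉ A.span.1} ⊆ f A ⁻¹' K := fun v hv =>
      (hmemK A v hv).2 (subset_closure (hCB _ hA _ (A.span_le_span_snoc v hv)))
    exact fun v => closure_minimal hsub (hK.preimage (hf₂' A)) (hd v)
  intro c hc b hcb
  obtain ⟨A, rfl⟩ := Frame.span_surjective c
  -- Since `span` is open and continuous, taking preimages commutes with closure.
  have hA : A ∈ closure (Frame.span ⁻¹' C) := by
    rw [← Frame.isOpenMap_span.preimage_closure_eq_closure_preimage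
      Frame.isQuotientMap_span.continuous]
    exact hc
  obtain ⟨v, hv, rfl⟩ := A.exists_span_snoc_eq b hcb
  exact (hmemK A v hv).1 (closure_minimal hCT hT hA v)

/-- The left-hand frames form a closed subset of the irreducible right-hand ones. It is proper: any
`c` inside some `b ∈ B` has a basis extending to a frame of `b`, so equality would put every such
`c` in `C` and make `B` everything. -/
lemma topologicalKrullDim_preimage_dropLast_add_one_le {B : Set (Gr k N (m + 1))} {C : Set (Gr k N m)}
    (hB : IsIrreducible B) (hBne : B ≠ Set.univ)
    (hCB : ∀ c ∈ C, ∀ b : Gr k N (m + 1), c.1 ≤ b.1 → b ∈ B) (hC : IsClosed C) :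
    topologicalKrullDim {A : Frame k N (m + 1) | A.dropLast.span ∈ C} + 1 ≤
      topologicalKrullDim (Frame.span ⁻¹' B) := by
  have hirr := Frame.isIrreducible_preimage_span hB
  have : IrreducibleSpace (Frame.span ⁻¹' B) :=
    { Subtype.preirreducibleSpace hirr.2 with toNonempty := hirr.1.to_subtype }
  let E : Set (Frame.span ⁻¹' B) := {A | A.1.dropLast.span ∈ C}
  have hsub : ∀ A : Frame k N (m + 1), A.dropLast.span ∈ C → A.span ∈ B := fun A hA =>
    hCB _ hA _ (Submodule.span_mono (by rintro _ ⟨i, rfl⟩; exact ⟨i.castSucc, rfl⟩))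
  have hE : IsClosed E := hC.preimage (Frame.isQuotientMap_span.continuous.comp
    (Frame.continuous_dropLast.comp continuous_subtype_val))
  have hne : E ≠ Set.univ := fun h => hBne <| by
    refine Gr.eq_univ_of_incidence hB.nonempty hCB fun b hb c hcb => ?_
    obtain ⟨A, rfl⟩ := Frame.span_surjective c
    obtain ⟨v, hv, rfl⟩ := A.exists_span_snoc_eq b hcb
    have : (⟨A.snoc v hv, hb⟩ : Frame.span ⁻¹' B) ∈ E := by rw [h]; trivial
    change (Frame.dropLast (A.snoc v hv)).span ∈ C at this
    rwa [Frame.dropLast_snoc] at this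
  let ι : {A : Frame k N (m + 1) | A.dropLast.span ∈ C} → E := fun A => ⟨⟨A.1, hsub A.1 A.2⟩, A.2⟩
  have hι : IsInducing ι :=
    (IsInducing.of_comp_iff (IsInducing.subtypeVal.comp IsInducing.subtypeVal)).1
      (IsInducing.subtypeVal : IsInducing
        (Subtype.val : {A : Frame k N (m + 1) | A.dropLast.span ∈ C} → _))
  exact (add_le_add_left hι.topologicalKrullDim_le 1).trans (topologicalKrullDim_add_one_le hE hne)

end Incidence

/-! ### The codimension estimate -/

lemma natCast_le_of_natCast_add_le {a b : ℕ} {G : WithBot ℕ∞}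
    (h : ((a + b : ℕ) : WithBot ℕ∞) ≤ G + (b : ℕ)) : (a : WithBot ℕ∞) ≤ G := by
  induction G with
  | bot => simp at h
  | coe G =>
    induction G with
    | top => exact le_top
    | coe G =>
      have : a + b ≤ G + b := by exact_mod_cast h
      exact_mod_cast (by omega : a ≤ G)

theorem mainTheorem3 {k : Type*} [Field k] [IsAlgClosed k] (m n ε : ℕ) (hmn : m ≤ n)
    (hε : 1 ≤ ε)
    (B : Set (Gr k (n + 1) (m + 1))) (hB : IsIrreducible B) (hBcodim : CodimAtLeast B ε)
    (C : Set (Gr k (n + 1) m)) (hC : C.Nonempty)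
    (hCB : ∀ c ∈ C, ∀ b : Gr k (n + 1) (m + 1), c.1 ≤ b.1 → b ∈ B) :
    CodimAtLeast C (ε + 1) := by
  have hG' := Gr.topologicalKrullDim_add_le (k := k) (N := n + 1) (r := m + 1)
  -- Otherwise `dim G + ε ≤ dim G`, which contradicts `1 ≤ ε` once `dim G` is known to be finite:
  -- `h₃` excludes `⊥` and `hG'` excludes `⊤`.
  have hBne : closure B ≠ Set.univ := by
    intro h
    have h₁ : topologicalKrullDim (Gr k (n + 1) (m + 1)) ≤ topologicalKrullDim (closure B) := by
      rw [h]
      exact (Homeomorph.Set.univ _).symm.isInducing.topologicalKrullDim_le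
    have h₂ := (add_le_add_left h₁ (ε : WithBot ℕ∞)).trans hBcodim
    have h₃ := Gr.le_topologicalKrullDim_add (k := k) (by omega : m + 1 ≤ n + 1)
    generalize topologicalKrullDim (Gr k (n + 1) (m + 1)) = G at *
    induction G with
    | bot =>
      rw [WithBot.bot_add] at h₃
      exact absurd h₃ (not_le_of_gt (WithBot.bot_lt_coe _))
    | coe G =>
      induction G with
      | top =>
        have h₅ : (⊤ : ℕ∞) + ((m + 1) * (m + 1) : ℕ) ≤ ((m + 1) * (n + 1) : ℕ) := by
          exact_mod_cast hG'
        rw [top_add, top_le_iff] at h₅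
        exact absurd h₅ (ENat.natCast_ne_top _)
      | coe G =>
        have : G + ε ≤ G := by exact_mod_cast h₂
        omega
  have hinc := mem_closure_of_incidence hCB (by omega)
  refine add_natCast_le_of_forall_natCast fun a ha => ?_
  obtain ⟨L, hL⟩ := Frame.exists_le_topologicalKrullDim_slice ha
  have h₁ := Frame.topologicalKrullDim_slice_add_le_preimage_dropLast isClosed_closure
    (by omega : m < n + 1) L (Z := closure C)
  have h₂ := topologicalKrullDim_preimage_dropLast_add_one_le hB.closure hBne hinc isClosed_closure
  have h₃ := Frame.topologicalKrullDim_preimage_span_le (isClosed_closure (s := B))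
  have h₄ := Gr.le_topologicalKrullDim_add (k := k) (by omega : m ≤ n + 1)
  -- Adding `m * m + (n + 1)` passes from `C` to the frames of `m + 1` vectors over it and avoids
  -- subtraction in `WithBot ℕ∞`.
  refine natCast_le_of_natCast_add_le (b := m * m + (n + 1)) ?_
  calc ((a + (ε + 1) + (m * m + (n + 1)) : ℕ) : WithBot ℕ∞)
      = a + (m * m + (n + 1) : ℕ) + 1 + ε := by push_cast; ring
    _ ≤ topologicalKrullDim (Frame.span ⁻¹' closure B) + ε := by
        gcongr
        exact le_trans (by gcongr; exact (add_le_add_left hL _).trans h₁) h₂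
    _ ≤ topologicalKrullDim (closure B) + ((m + 1) * (m + 1) : ℕ) + ε := by gcongr
    _ = topologicalKrullDim (closure B) + ε + ((m + 1) * (m + 1) : ℕ) := add_right_comm _ _ _
    _ ≤ topologicalKrullDim (Gr k (n + 1) (m + 1)) + ((m + 1) * (m + 1) : ℕ) := by
        gcongr
        exact hBcodim
    _ ≤ (((m + 1) * (n + 1) : ℕ) : WithBot ℕ∞) := hG'
    _ = ((m * (n + 1) : ℕ) : WithBot ℕ∞) + (n + 1 : ℕ) := by push_cast; ring
    _ ≤ topologicalKrullDim (Gr k (n + 1) m) + (m * m : ℕ) + (n + 1 : ℕ) := by gcongr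
    _ = topologicalKrullDim (Gr k (n + 1) m) + (m * m + (n + 1) : ℕ) := by
        rw [add_assoc, ← Nat.cast_add]
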